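/- Let $A$ be a finite-dimensional real alternative algebra with unit $1\neq 0$ ($\mathbb R$ is identified with $\mathbb R 1$), equipped with an $\mathbb R$-linear involution $x\mapsto x^c$ such that $(xy)^c=y^cx^c$ and $r^c=r$ for $r\in\mathbb R$. Put $t(x)=x+x^c$, $n(x)=xx^c$, $\mathbb S_A=\{x\in A: t(x)=0,\ n(x)=1\}$ and $Q_A=\mathbb R\cup\{x\in A: t(x),n(x)\in\mathbb R,\ t(x)^2<4n(x)\}$, and assume that $A$ carries a norm with $\|x\|^2=n(x)$ for all $x\in Q_A$. Write $\mathbb C_J=\mathbb R+\mathbb RJ$ for $J\in\mathbb S_A$, and $\mathbb S_y=\alpha+\beta\,\mathbb S_A$ for $y=\alpha+\beta J\in Q_A$ ($\alpha,\beta\in\mathbb R$, $J\in\mathbb S_A$). Let $D\subseteq\mathbb C$ be nonempty and invariant under conjugation, and suppose that $\Omega=\{\alpha+\beta J:\alpha+i\beta\in D,\ J\in\mathbb S_A\}$ is open in $Q_A$. Let $f:\Omega\to A$ be slice regular, i.e. $f(\alpha+\beta J)=F_1(\alpha+i\beta)+J\,F_2(\alpha+i\beta)$ for a $\mathscr C^1$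 function $F=F_1+\imath F_2:D\to A\otimes_{\mathbb R}\mathbb C$ with $F(\bar z)=\overline{F(z)}$ and $\partial F/\partial\alpha+\imath\,\partial F/\partial\beta=0$. Let $\cdot$ denote the slice product (induced by the pointwise product of the functions $F$), $(x-y)^{\bullet n}$ the powers of $x-y$ for this product, and $\Delta_y(x)=x^2-x\,t(y)+n(y)$. For $x,y\in Q_A$ let $\sigma(x,y)=\tau(x,y)=\|x-y\|$ if $x,y$ lie in a common $\mathbb C_J$; otherwise let $\sigma(x,y)$ and $\tau(x,y)$ be the square roots of $(\mathrm{Re}\,x-\mathrm{Re}\,y)^2+(\|\mathrm{Im}\,x\|\pm\|\mathrm{Im}\,y\|)^2$, with sign $+$ for $\sigma$ and $-$ for $\tau$, where $\mathrm{Re}\,x=t(x)/2$ and $\mathrm{Im}\,x=x-\mathrm{Re}\,x$. A point $y\in Q_A$ is a singularity for $f$ if $\Sigma(y,0,R)=\{x\in Q_A:\tau(x,y)>0,\ \sigma(x,y)<R\}\subseteq\Omega$ for some $R>0$. In that case $f$ has a Laurent expansion $f(x)=\sum_{n\in\mathbb Z}(x-y)^{\bullet n}\cdot a_n$ on such a set,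 and $\mathrm{ord}_f(y)\in\mathbb N\cup\{+\infty\}$ is the least $m$ such that $a_{-k}=0$ for all $k>m$ ($+\infty$ if there is none). It also has a spherical Laurent expansion $f(x)=\sum_{n\in\mathbb Z}\mathscr S_{y,n}(x)\cdot c_n$ on $\{x\in Q_A:0<\|\Delta_y(x)\|^{1/2}<r\}\subseteq\Omega$ for some $r>0$, where $\mathscr S_{y,2k}=\Delta_y^k$ and $\mathscr S_{y,2k+1}=\Delta_y^k\,(x-y)$; the spherical order $\mathrm{ord}_f(\mathbb S_y)$ is the least even natural number $n_0$ such that $c_n=0$ for all $n<-n_0$ ($+\infty$ if there is none). **Theorem.** Let $y\in Q_A\setminus\mathbb R$ be a singularity for $f$ with $2\,\mathrm{ord}_f(y)<\mathrm{ord}_f(\mathbb S_y)$. There exists a real affine subspace $H$ of $A$ through $y$ such that $$\{x\in\mathbb S_y:\ 2\,\mathrm{ord}_f(x)<\mathrm{ord}_f(\mathbb S_y)\}=\mathbb S_y\cap H.$$ Let $W\subseteq\mathbb S_y$ contain $y$ and be connected in the Zariski (respectively Euclidean) topology. Then one of the following holds: 1. for all $x\in W$, $2\,\mathrm{ord}_f(x)<\mathrm{ord}_f(\mathbb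 S_y)=2\,\mathrm{ord}_f(x^c)$; 2. there is a nonempty subset $\widetilde W$ of $W$, relatively open in $W$ in the Zariski (respectively Euclidean) topology, such that $2\,\mathrm{ord}_f(x)=\mathrm{ord}_f(\mathbb S_y)=2\,\mathrm{ord}_f(x^c)$ for all $x\in\widetilde W$. Case 1 is excluded under any of the following additional assumptions, where $W^c=\{x^c:x\in W\}$: (a) $W^c=W$; (b) $W\cap W^c\neq\emptyset$; (c) there exist distinct $y',y''\in W$ such that $y'-y''$ is not a left zero divisor; (d) there exists $y'\in W$ with $2\,\mathrm{ord}_f(y')=\mathrm{ord}_f(\mathbb S_y)$. Finally, let $Y$ be an irreducible component of the real algebraic set $\mathbb S_y$ with $y\in Y$. Then one of the following holds: 1'. for all $x\in Y$, $2\,\mathrm{ord}_f(x)<\mathrm{ord}_f(\mathbb S_y)=2\,\mathrm{ord}_f(x^c)$; 2'. there is a real algebraic subset $Y'$ of $Y$ with $\dim_{\mathbb R}Y'<\dim_{\mathbb R}Y$ (where $\dim_{\mathbb R}\emptyset=-\infty$) such that $2\,\mathrm{ord}_f(x)=2\,\mathrm{ord}_f(x^c)=\mathrm{ord}_f(\mathbb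 S_y)$ for every $x\in Y\setminus Y'$. -/

import Mathlib

/-- A possibly nonassociative unital ring whose additive group carries a norm (no compatibility
between the norm and the multiplication is required). -/
class NormedNonAssocRing (A : Type*) extends NormedAddCommGroup A, NonAssocRing A

/-- The associator `(x * y) * z - x * (y * z)` is alternating. -/
class IsAlternativeRing (A : Type*) [NonAssocRing A] : Prop where
  associator_left : ∀ x y : A, associator x x y = 0
  associator_right : ∀ x y : A, associator y x x = 0

namespace SliceAnalysis

noncomputable section

variable {A : Type*} [NormedNonAssocRing A] [NormedSpace ℝ A]

variable (A) in
/-- The Euclidean topology of the finite dimensional normed space `A`. -/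
@[reducible] def euclideanTopology : TopologicalSpace A := inferInstance

/-! ### The quadratic cone -/

variable (A) in
/-- The copy of `ℝ` in `A`, generated by `1`. -/
def realLine : Set A := Set.range fun r : ℝ => r • (1 : A)

open Classical in
/-- The real number `r` such that `a = r • 1`, for `a` in the real line of `A`
(and `0` for all other `a`). -/
def toReal (a : A) : ℝ := if h : ∃ r : ℝ, a = r • (1 : A) then h.choose else 0

theorem toReal_smul_one [Nontrivial A] (r : ℝ) : toReal (r • (1 : A)) = r := by
  have h : ∃ s : ℝ, r • (1 : A) = s • (1 : A) := ⟨r, rfl⟩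
  have h1 : r • (1 : A) = h.choose • (1 : A) := h.choose_spec
  rw [toReal, dif_pos h]
  exact (smul_left_injective ℝ (one_ne_zero (α := A)) h1).symm

variable [StarRing A]

/-- The trace `t(x) = x + x^c`, where `x^c = star x`. -/
def trace (x : A) : A := x + star x

/-- The (squared) norm `n(x) = x x^c`. -/
def normSq (x : A) : A := x * star x

variable (A) in
/-- The set `𝕊_A` of imaginary units. -/
def imagUnits : Set A := {x | trace x = 0 ∧ normSq x = 1}

variable (A) in
/-- The quadratic cone `Q_A`. -/
def quadraticCone : Set A :=
  realLine A ∪ {x | trace x ∈ realLine A ∧ normSq x ∈ realLine A ∧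
    toReal (trace x) ^ 2 < 4 * toReal (normSq x)}

/-- The element `α + β J`, where `z = α + β i`. -/
def slicePt (J : A) (z : ℂ) : A := z.re • (1 : A) + z.im • J

/-- The complex plane `ℂ_J` through the imaginary unit `J`. -/
def slicePlane (J : A) : Set A := Set.range (slicePt J)

/-- The circularization `Ω_E` of `E ⊆ ℂ`. -/
def circularization (E : Set ℂ) : Set A :=
  {x | x ∈ quadraticCone A ∧ ∃ z ∈ E, ∃ J ∈ imagUnits A, x = slicePt J z}

/-- The sphere `𝕊_y = α + β 𝕊_A` through `y = α + β J`. -/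
def sphere (y : A) : Set A :=
  {x | ∃ z : ℂ, ∃ J ∈ imagUnits A, ∃ I ∈ imagUnits A, y = slicePt J z ∧ x = slicePt I z}

/-- The real part `t(x) / 2`, as an element of `A`. -/
def rePart (x : A) : A := (1 / 2 : ℝ) • (x + star x)

/-- The imaginary part `x - re(x)`. -/
def imPart (x : A) : A := x - rePart x

/-! ### The complexified algebra, slice functions and slice regular functions

An element `x + ι y` of the complexified algebra `A_ℂ = A ⊗ ℂ` is the pair `(x, y) : A × A`. -/

/-- The product `(x + ι y)(x' + ι y') = xx' - yy' + ι (xy' + yx')` of `A_ℂ`. -/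
def cMul (p q : A × A) : A × A := (p.1 * q.1 - p.2 * q.2, p.1 * q.2 + p.2 * q.1)

/-- The inclusion `α + β i ↦ α + ι β` of `ℂ ≃ ℝ + ι ℝ` into the centre of `A_ℂ`. -/
def ofC (w : ℂ) : A × A := (w.re • (1 : A), w.im • (1 : A))

/-- The inclusion `a ↦ a + ι 0` of `A` into `A_ℂ`. -/
def ofA (a : A) : A × A := (a, 0)

/-- Powers in `A_ℂ`. -/
def cPow (p : A × A) : ℕ → A × A
  | 0 => (1, 0)
  | n + 1 => cMul (cPow p n) p

/-- The map `x + ι y ↦ x + J y` from `A_ℂ` to `A`. A stem function `F` induces the slice function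
`slicePt J z ↦ cEval J (F z)`. -/
def cEval (J : A) (p : A × A) : A := p.1 + J * p.2

/-- `F = F₁ + ι F₂` is a stem function on `D`: `F (conj z) = conj (F z)`. -/
def IsStemOn (D : Set ℂ) (F : ℂ → A × A) : Prop :=
  ∀ z ∈ D, (F (starRingEnd ℂ z)).1 = (F z).1 ∧ (F (starRingEnd ℂ z)).2 = -(F z).2

/-- The function `f` on the circularization of `D` is induced by `F`. -/
def IsInducedOn (D : Set ℂ) (F : ℂ → A × A) (f : A → A) : Prop :=
  ∀ z ∈ D, ∀ J ∈ imagUnits A, f (slicePt J z) = cEval J (F z)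

/-- `f` is a slice regular function on `Ω`: the set `Ω` is the circularization of a nonempty
conjugation invariant `D ⊆ ℂ` and it is open in the quadratic cone, and `f` is induced on `Ω` by a
stem function `F` of class `C¹` with `∂F/∂α + ι ∂F/∂β = 0`. The values of `f` outside `Ω` play no
role here or below. -/
def IsSliceRegularOn (Ω : Set A) (f : A → A) : Prop :=
  ∃ D : Set ℂ, D.Nonempty ∧ (∀ z ∈ D, starRingEnd ℂ z ∈ D) ∧ Ω = circularization D ∧
    (∃ O : Set A, IsOpen O ∧ Ω = quadraticCone A ∩ O) ∧
    ∃ F : ℂ → A × A, IsStemOn D F ∧ IsInducedOn D F f ∧ ContDiffOn ℝ 1 F D ∧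
      ∀ z ∈ D, fderiv ℝ F z 1 + cMul (ofC Complex.I) (fderiv ℝ F z Complex.I) = 0

/-! ### Singularities and Laurent expansions -/

/-- `x` and `y` lie in the same plane `ℂ_J`. -/
def SameSlice (x y : A) : Prop := ∃ J ∈ imagUnits A, x ∈ slicePlane J ∧ y ∈ slicePlane J

open Classical in
/-- The distance `σ_A` on the quadratic cone. -/
def sigmaDist (x y : A) : ℝ :=
  if SameSlice x y then ‖x - y‖
  else Real.sqrt (‖rePart x - rePart y‖ ^ 2 + (‖imPart x‖ + ‖imPart y‖) ^ 2)

open Classical in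
/-- The pseudodistance `τ_A` on the quadratic cone. -/
def tauDist (x y : A) : ℝ :=
  if SameSlice x y then ‖x - y‖
  else Real.sqrt (‖rePart x - rePart y‖ ^ 2 + (‖imPart x‖ - ‖imPart y‖) ^ 2)

/-- The set `Σ(y, R₁, R₂)`. -/
def sigmaShell (y : A) (R₁ R₂ : ℝ) : Set A :=
  {x | x ∈ quadraticCone A ∧ R₁ < tauDist x y ∧ sigmaDist x y < R₂}

/-- `y` is a singularity for the slice regular functions on `Ω`. -/
def IsSingularity (Ω : Set A) (y : A) : Prop :=
  y ∈ quadraticCone A ∧ ∃ R : ℝ, 0 < R ∧ sigmaShell y 0 R ⊆ Ω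

/-- The stem function `z ↦ z² - z t(y) + n(y)` of `Δ_y`; its values are in `ℝ + ι ℝ ≃ ℂ`. -/
def deltaStem (y : A) (z : ℂ) : ℂ :=
  z ^ 2 - z * (toReal (trace y) : ℂ) + (toReal (normSq y) : ℂ)

/-- The stem function of the slice power `(x - y)^{• n}`, `n ∈ ℤ`. For negative exponents it is a
power of the stem function of `(x - y)^{-•} = Δ_y(x)⁻¹ (x - y^c)`. -/
def binomStem (y : A) : ℤ → ℂ → A × A
  | Int.ofNat n, z => cPow (ofC z - ofA y) n
  | Int.negSucc n, z => cPow (cMul (ofC (deltaStem y z)⁻¹) (ofC z - ofA (star y))) (n + 1)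

/-- `f(x) = ∑_{n ∈ ℤ} (x - y)^{• n} · a_n` on some `Σ(y, 0, R) ⊆ Ω`, `R > 0`, where `·` is the slice
product (induced by the pointwise product of stem functions). -/
def HasLaurentExpansion (Ω : Set A) (f : A → A) (y : A) (a : ℤ → A) : Prop :=
  ∃ R : ℝ, 0 < R ∧ sigmaShell y 0 R ⊆ Ω ∧
    ∀ z : ℂ, ∀ J ∈ imagUnits A, slicePt J z ∈ sigmaShell y 0 R →
      HasSum (fun n : ℤ => cEval J (cMul (binomStem y n z) (ofA (a n)))) (f (slicePt J z))

/-- The order `ord_f(y)`: the least `m` such that `a_{-k} = 0` for all `k > m`, where the `a_n` are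
the coefficients of the Laurent expansion of `f` at `y`, and `⊤` if there is no such `m`. -/
def order (Ω : Set A) (f : A → A) (y : A) : ℕ∞ :=
  sInf {N | ∃ m : ℕ, N = (m : ℕ∞) ∧ ∃ a : ℤ → A, HasLaurentExpansion Ω f y a ∧
    ∀ k : ℕ, m < k → a (-(k : ℤ)) = 0}

/-- The function `Δ_y(x) = x² - x t(y) + n(y)`. -/
def delta (y x : A) : A := x * x - toReal (trace y) • x + toReal (normSq y) • (1 : A)

/-- The Cassini shell `U(y, r₁, r₂)`, for the Cassini pseudodistance `u(x, y) = √‖Δ_y(x)‖`. -/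
def cassiniShell (y : A) (r₁ r₂ : ℝ) : Set A :=
  {x | x ∈ quadraticCone A ∧ r₁ < Real.sqrt ‖delta y x‖ ∧ Real.sqrt ‖delta y x‖ < r₂}

/-- The stem function of `𝒮_{y,n}`, where `𝒮_{y,2k} = Δ_y^k` and `𝒮_{y,2k+1} = Δ_y^k (x - y)`. -/
def sphericalStem (y : A) (n : ℤ) (z : ℂ) : A × A :=
  if Even n then ofC (deltaStem y z ^ (n / 2))
  else cMul (ofC (deltaStem y z ^ (n / 2))) (ofC z - ofA y)

/-- `f(x) = ∑_{n ∈ ℤ} 𝒮_{y,n}(x) · c_n` on some Cassini shell `U(y, 0, r) ⊆ Ω`, `r > 0`. -/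
def HasSphericalExpansion (Ω : Set A) (f : A → A) (y : A) (c : ℤ → A) : Prop :=
  ∃ r : ℝ, 0 < r ∧ cassiniShell y 0 r ⊆ Ω ∧
    ∀ z : ℂ, ∀ J ∈ imagUnits A, slicePt J z ∈ cassiniShell y 0 r →
      HasSum (fun n : ℤ => cEval J (cMul (sphericalStem y n z) (ofA (c n)))) (f (slicePt J z))

/-- The spherical order `ord_f(𝕊_y)`: the least even natural number `n₀` such that `c_n = 0` for all
`n < -n₀`, where the `c_n` are the coefficients of the spherical Laurent expansion of `f` at `y`,
and `⊤` if there is no such `n₀`. -/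
def sphericalOrder (Ω : Set A) (f : A → A) (y : A) : ℕ∞ :=
  sInf {N | ∃ n₀ : ℕ, Even n₀ ∧ N = (n₀ : ℕ∞) ∧ ∃ c : ℤ → A, HasSphericalExpansion Ω f y c ∧
    ∀ n : ℤ, n < -(n₀ : ℤ) → c n = 0}

end

end SliceAnalysis

namespace RealAlgebraic

noncomputable section

variable (E : Type*) [AddCommGroup E] [Module ℝ E]

/-- The polynomial functions on a real vector space: the algebra generated by the linear forms. -/
def polyFun : Subalgebra ℝ (E → ℝ) :=
  Algebra.adjoin ℝ (Set.range fun l : Module.Dual ℝ E => (l : E → ℝ))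

variable {E}

/-- Real algebraic subsets: the common zero sets of families of polynomial functions. -/
def IsAlgebraicSet (V : Set E) : Prop :=
  ∃ S : Set (E → ℝ), S ⊆ (polyFun E : Set (E → ℝ)) ∧ V = {x | ∀ p ∈ S, p x = 0}

variable (E) in
/-- The Zariski topology, whose closed sets are the real algebraic subsets. -/
@[reducible] def zariskiTopology : TopologicalSpace E :=
  TopologicalSpace.ofClosed {V : Set E | IsAlgebraicSet V}
    (by
      refine ⟨{1}, ?_, ?_⟩
      · rintro _ rfl
        exact (polyFun E).one_mem
      · ext x
        simp)
    (by
      intro T hT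
      have hT' : ∀ V ∈ T, ∃ S : Set (E → ℝ),
          S ⊆ (polyFun E : Set (E → ℝ)) ∧ V = {x | ∀ p ∈ S, p x = 0} := fun V hV => hT hV
      choose! S hS hV using hT'
      refine ⟨⋃ V ∈ T, S V, ?_, ?_⟩
      · intro p hp
        simp only [Set.mem_iUnion] at hp
        obtain ⟨V, hVT, hp⟩ := hp
        exact hS V hVT hp
      · ext x
        simp only [Set.mem_sInter, Set.mem_iUnion, Set.mem_ofPred_eq]
        constructor
        · rintro h p ⟨V, hVT, hp⟩
          have hx := h V hVT
          rw [hV V hVT] at hx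
          exact hx p hp
        · intro h V hVT
          rw [hV V hVT]
          exact fun p hp => h p ⟨V, hVT, hp⟩)
    (by
      rintro V ⟨S, hS, rfl⟩ W ⟨T, hT, rfl⟩
      refine ⟨{r | ∃ p ∈ S, ∃ q ∈ T, r = p * q}, ?_, ?_⟩
      · rintro _ ⟨p, hp, q, hq, rfl⟩
        exact (polyFun E).mul_mem (hS hp) (hT hq)
      · ext x
        simp only [Set.mem_union, Set.mem_ofPred_eq]
        constructor
        · rintro (h | h) _ ⟨p, hp, q, hq, rfl⟩
          · simp [h p hp]
          · simp [h q hq]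
        · intro h
          by_contra! hc
          obtain ⟨⟨p, hp, hpx⟩, q, hq, hqx⟩ := hc
          exact (mul_ne_zero hpx hqx) (h _ ⟨p, hp, q, hq, rfl⟩))

/-- The algebra of restrictions to `V` of polynomial functions, i.e. the quotient of the polynomial
algebra by the ideal of the polynomials that vanish on `V`. -/
def polyFunOn (V : Set E) : Subalgebra ℝ (V → ℝ) :=
  (polyFun E).map (AlgHom.pi fun x : V => Pi.evalAlgHom ℝ (fun _ : E => ℝ) x.1)

/-- The dimension of a real algebraic set: the Krull dimension of its ring of polynomial functions.
The empty set has dimension `⊥`. -/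
def dim (V : Set E) : WithBot ℕ∞ := ringKrullDim (polyFunOn V)

/-- `Y` is an irreducible component of the real algebraic set `V`. -/
def IsIrreducibleComponent (V Y : Set E) : Prop :=
  Maximal (fun Z : Set E => Z ⊆ V ∧ @IsIrreducible E (zariskiTopology E) Z) Y

end

end RealAlgebraic

/-!
A slice function is determined by its stem function `F`, with values in the complexified algebra
`A ⊗ ℂ`, through `f (α + β J) = ev_J (F (α + β i))` with `ev_J (a + ι b) = a + J b`. By Artin's theorem
left multiplication by an imaginary unit `J` is a complex structure on `A`, for which `ev_J` is complex
linear; and `a + ι b` is recovered from its values at `J` and `-J`. Slice regularity means that `F` is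
holomorphic. Write `y = α + β J` with `z₀ = α + β i` and `β > 0`.

* The order of `f` at a point `α + β I` of the sphere is the order of the pole at `z₀` of the
  holomorphic function `ev_I ∘ F` (`exists_hasLaurentExpansion_iff`), because on `ℂ_I` the slice powers
  of `x - y` are ordinary powers (`cEval_binomStem`).
* The spherical order is twice the order of the pole of `F` itself at `z₀`
  (`exists_hasSphericalExpansion_iff`). The hard half is the construction of a spherical expansion:
  near `z₀` the function `w = Δ_y(z)` is a local coordinate, and a function holomorphic in `w` is
  split into `P(w) + (z - α) Q(w)` with `P` and `Q` having Taylor coefficients in `A`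
  (`exists_hasSum_pow_mul_coords`).

No Laurent series is needed for this: "pole of order at most `m`" is expressed by the boundedness of
`(z - z₀)^m F`, and removable singularities give power series.

Hence `2 ord_f(α + β I) < ord_f(𝕊_y)` says that, for some `m`, the function `(z - z₀)^m F` is unbounded
near `z₀` while its evaluation at `I` is bounded. The evaluation is affine in `I`, so such `I` form the
trace on `𝕊_A` of an affine subspace (`exceptionalSubspace`); all other points of the sphere satisfy
`2 ord_f(x) = ord_f(𝕊_y)`. Boundedness of the evaluations at `I` and `-I` would bound `(z - z₀)^m F`, so
`x` and `x^c` are never both exceptional (`neg_notMem_lowPoles`). For the same reason the difference of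
two exceptional points is a left zero divisor (`exists_mul_eq_zero_of_mem_lowPoles`).

The rest is topology. Let `H` be the exceptional subspace and `H'` its conjugate. Both are closed in
the Euclidean and in the Zariski topology, and they are disjoint on the sphere. A connected subset
containing `y ∈ H` is therefore contained in `H`, or not contained in `H ∪ H'`. An irreducible component
`Y` is contained in `H`, or meets `H ∪ H'` in a proper algebraic subset, which has smaller dimension
because the coordinate ring of `Y` is a domain of finite Krull dimension (`dim_lt_dim`).
-/

open Complex Filter Topology ComplexConjugate Asymptotics

set_option linter.unusedSectionVars false

namespace SliceAnalysis

/-! ### Algebra in the planes `ℂ_J` -/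

section Algebra

variable {A : Type*} [NormedNonAssocRing A] [NormedSpace ℝ A] [StarRing A]

theorem star_of_mem_imagUnits {J : A} (hJ : J ∈ imagUnits A) : star J = -J :=
  (neg_eq_of_add_eq_zero_right hJ.1).symm

theorem mul_self_of_mem_imagUnits {J : A} (hJ : J ∈ imagUnits A) : J * J = -1 := by
  have h := hJ.2
  rw [normSq, star_of_mem_imagUnits hJ, mul_neg] at h
  rw [← h, neg_neg]

/-- One half of Artin's theorem: left multiplication by an imaginary unit is a complex structure. -/
theorem mul_mul_of_mem_imagUnits [IsAlternativeRing A] {J : A} (hJ : J ∈ imagUnits A) (a : A) :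
    J * (J * a) = -a := by
  have h := IsAlternativeRing.associator_left J a
  rw [associator_apply, sub_eq_zero, mul_self_of_mem_imagUnits hJ] at h
  rw [← h, neg_mul, one_mul]

theorem neg_mem_imagUnits {J : A} (hJ : J ∈ imagUnits A) : -J ∈ imagUnits A := by
  have h := hJ.1
  have h2 := hJ.2
  simp only [trace, normSq] at h h2
  constructor
  · rw [trace, star_neg, ← neg_add, h, neg_zero]
  · rw [normSq, star_neg, neg_mul_neg, h2]

theorem slicePt_neg (J : A) (z : ℂ) : slicePt (-J) z = slicePt J (conj z) := by
  simp [slicePt]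

theorem slicePt_conj_neg (J : A) (z : ℂ) : slicePt (-J) (conj z) = slicePt J z := by
  simp [slicePt]

theorem slicePt_ofReal (J : A) (r : ℝ) : slicePt J (r : ℂ) = r • (1 : A) := by
  simp [slicePt]

theorem slicePt_one (J : A) : slicePt J 1 = 1 := by
  simp [slicePt]

theorem slicePt_sub (J : A) (z w : ℂ) : slicePt J (z - w) = slicePt J z - slicePt J w := by
  simp only [slicePt, sub_re, sub_im, sub_smul]; abel

theorem slicePt_mul [IsScalarTower ℝ A A] [SMulCommClass ℝ A A] {J : A} (hJ : J ∈ imagUnits A)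
    (z w : ℂ) : slicePt J (z * w) = slicePt J z * slicePt J w := by
  simp only [slicePt, mul_re, mul_im, mul_add, add_mul, smul_mul_assoc, mul_smul_comm, one_mul,
    mul_one, mul_self_of_mem_imagUnits hJ]
  module

/-- The other half of Artin's theorem needed here: `ℂ_J` acts on `A` by left multiplication. -/
theorem slicePt_mul_mul [IsScalarTower ℝ A A] [SMulCommClass ℝ A A] [IsAlternativeRing A] {J : A}
    (hJ : J ∈ imagUnits A) (z w : ℂ) (a : A) :
    slicePt J z * (slicePt J w * a) = slicePt J (z * w) * a := by
  simp only [slicePt, mul_re, mul_im, mul_add, add_mul, smul_mul_assoc, mul_smul_comm, one_mul,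
    mul_mul_of_mem_imagUnits hJ]
  module

theorem star_slicePt [StarModule ℝ A] {J : A} (hJ : J ∈ imagUnits A) (z : ℂ) :
    star (slicePt J z) = slicePt (-J) z := by
  simp [slicePt, star_of_mem_imagUnits hJ]

theorem trace_slicePt [StarModule ℝ A] {J : A} (hJ : J ∈ imagUnits A) (z : ℂ) :
    trace (slicePt J z) = (2 * z.re) • (1 : A) := by
  rw [trace, star_slicePt hJ]
  simp only [slicePt]
  module

variable [StarModule ℝ A] [IsScalarTower ℝ A A] [SMulCommClass ℝ A A]

theorem normSq_slicePt {J : A} (hJ : J ∈ imagUnits A) (z : ℂ) :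
    normSq (slicePt J z) = Complex.normSq z • (1 : A) := by
  rw [normSq, star_slicePt hJ, slicePt_neg, ← slicePt_mul hJ, mul_conj, slicePt_ofReal]

theorem smul_one_inj [Nontrivial A] {r s : ℝ} : r • (1 : A) = s • (1 : A) ↔ r = s :=
  ⟨fun h => smul_left_injective ℝ (one_ne_zero (α := A)) h, fun h => by rw [h]⟩

variable [Nontrivial A]

theorem toReal_trace_slicePt {J : A} (hJ : J ∈ imagUnits A) (z : ℂ) :
    toReal (trace (slicePt J z)) = 2 * z.re := by
  rw [trace_slicePt hJ, toReal_smul_one]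

theorem toReal_normSq_slicePt {J : A} (hJ : J ∈ imagUnits A) (z : ℂ) :
    toReal (normSq (slicePt J z)) = Complex.normSq z := by
  rw [normSq_slicePt hJ, toReal_smul_one]

theorem slicePt_mem_quadraticCone {J : A} (hJ : J ∈ imagUnits A) (z : ℂ) :
    slicePt J z ∈ quadraticCone A := by
  by_cases hz : z.im = 0
  · left
    exact ⟨z.re, by simp [slicePt, hz]⟩
  · right
    refine ⟨⟨_, (trace_slicePt hJ z).symm⟩, ⟨_, (normSq_slicePt hJ z).symm⟩, ?_⟩
    rw [toReal_trace_slicePt hJ, toReal_normSq_slicePt hJ, Complex.normSq_apply]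
    have := mul_self_pos.2 hz
    nlinarith

theorem exists_slicePt_of_notMem_realLine {x : A} (hx : x ∈ quadraticCone A)
    (hxr : x ∉ realLine A) : ∃ I ∈ imagUnits A, ∃ z : ℂ, x = slicePt I z := by
  rcases hx with hr | ⟨⟨t, ht⟩, ⟨n, hn⟩, hlt⟩
  · exact absurd hr hxr
  · simp only at ht hn
    rw [← ht, ← hn, toReal_smul_one, toReal_smul_one] at hlt
    -- the imaginary part is normalized by the square root of `n - (t/2)^2`
    set b : ℝ := Real.sqrt (n - (t / 2) ^ 2) with hb
    have hb2 : b ^ 2 = n - (t / 2) ^ 2 := Real.sq_sqrt (by nlinarith)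
    have hb0 : b ≠ 0 := by
      intro h
      rw [h] at hb2
      nlinarith
    have hs : star x = t • (1 : A) - x := by
      rw [ht, trace]; abel
    have hxs : x * x = t • x - n • (1 : A) := by
      rw [hn, normSq, hs, mul_sub, mul_smul_comm, mul_one]; abel
    refine ⟨b⁻¹ • (x - (t / 2) • (1 : A)), ⟨?_, ?_⟩, ⟨t / 2, b⟩, ?_⟩
    · simp only [trace, star_smul, star_sub, star_one, hs, star_trivial]
      module
    · have h1 : star (b⁻¹ • (x - (t / 2) • (1 : A))) = -(b⁻¹ • (x - (t / 2) • (1 : A))) := by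
        simp only [star_smul, star_sub, star_one, hs, star_trivial]
        module
      rw [normSq, h1]
      simp only [mul_neg, smul_mul_assoc, mul_smul_comm, mul_sub, sub_mul, one_mul, mul_one, hxs]
      have h2 : n = b ^ 2 + (t / 2) ^ 2 := by linarith
      rw [h2]
      match_scalars <;> field_simp <;> ring
    · simp only [slicePt]
      rw [smul_smul, mul_inv_cancel₀ hb0, one_smul]
      abel

theorem exists_slicePt_of_mem_quadraticCone {J : A} (hJ : J ∈ imagUnits A) {x : A}
    (hx : x ∈ quadraticCone A) : ∃ I ∈ imagUnits A, ∃ z : ℂ, x = slicePt I z := by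
  by_cases hr : x ∈ realLine A
  · obtain ⟨r, rfl⟩ := hr
    exact ⟨J, hJ, r, (slicePt_ofReal J r).symm⟩
  · exact exists_slicePt_of_notMem_realLine hx hr

variable (A) in
/-- The conjugation of `A` as a real linear map. -/
def starLin : A →ₗ[ℝ] A where
  toFun := star
  map_add' := star_add
  map_smul' r x := by rw [star_smul, star_trivial, RingHom.id_apply]

@[simp] theorem starLin_apply (x : A) : starLin A x = star x := rfl

end Algebra

section Norm

variable {A : Type*} [NormedNonAssocRing A] [NormedSpace ℝ A] [StarRing A]
  [StarModule ℝ A] [IsScalarTower ℝ A A] [SMulCommClass ℝ A A] [Nontrivial A]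

theorem norm_slicePt (hnorm : ∀ x ∈ quadraticCone A, (‖x‖ ^ 2 : ℝ) • (1 : A) = normSq x)
    {J : A} (hJ : J ∈ imagUnits A) (z : ℂ) : ‖slicePt J z‖ = ‖z‖ := by
  have h := hnorm _ (slicePt_mem_quadraticCone hJ z)
  rw [normSq_slicePt hJ, smul_one_inj, Complex.normSq_eq_norm_sq] at h
  exact (sq_eq_sq₀ (norm_nonneg _) (norm_nonneg _)).1 h

/-- Two representations of one point differ at most by `(J, z) ↦ (-J, conj z)`, unless the point is
real. -/
theorem slicePt_eq_slicePt (hnorm : ∀ x ∈ quadraticCone A, (‖x‖ ^ 2 : ℝ) • (1 : A) = normSq x)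
    {I J : A} (hI : I ∈ imagUnits A) (hJ : J ∈ imagUnits A) {z w : ℂ}
    (h : slicePt J z = slicePt I w) :
    (z = w ∨ z = conj w) ∧ (w.im ≠ 0 → (J = I ∧ z = w) ∨ (J = -I ∧ z = conj w)) := by
  have hre : z.re = w.re := by
    have h1 := congrArg trace h
    rw [trace_slicePt hJ, trace_slicePt hI, smul_one_inj] at h1
    linarith
  have him : z.im • J = w.im • I := by
    simpa [slicePt, hre] using h
  have habs : z.im = w.im ∨ z.im = -w.im := by
    have h1 := norm_slicePt hnorm hJ z
    rw [h, norm_slicePt hnorm hI, ← sq_eq_sq₀ (norm_nonneg _) (norm_nonneg _),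
      ← Complex.normSq_eq_norm_sq, ← Complex.normSq_eq_norm_sq, Complex.normSq_apply,
      Complex.normSq_apply, hre] at h1
    exact sq_eq_sq_iff_eq_or_eq_neg.1 (by linarith)
  rcases habs with h1 | h1
  · have hzw : z = w := Complex.ext hre h1
    refine ⟨Or.inl hzw, fun hw => Or.inl ⟨?_, hzw⟩⟩
    rw [h1] at him
    exact smul_right_injective A hw him
  · have hzw : z = conj w := Complex.ext (by simpa using hre) (by simpa using h1)
    refine ⟨Or.inr hzw, fun hw => Or.inr ⟨?_, hzw⟩⟩
    rw [h1, neg_smul, ← smul_neg] at him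
    exact neg_eq_iff_eq_neg.1 (smul_right_injective A hw him)

theorem deltaStem_slicePt {J : A} (hJ : J ∈ imagUnits A) (w z : ℂ) :
    deltaStem (slicePt J w) z = (z - w) * (z - conj w) := by
  rw [deltaStem, toReal_trace_slicePt hJ, toReal_normSq_slicePt hJ]
  have h1 : ((2 * w.re : ℝ) : ℂ) = w + conj w := (Complex.add_conj w).symm
  rw [h1, ← Complex.mul_conj]
  ring

theorem deltaStem_conj (y : A) (z : ℂ) : deltaStem y (conj z) = conj (deltaStem y z) := by
  simp [deltaStem]

theorem delta_slicePt {I : A} (hI : I ∈ imagUnits A) (y : A) (z : ℂ) :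
    delta y (slicePt I z) = slicePt I (deltaStem y z) := by
  rw [delta, deltaStem, ← slicePt_mul hI]
  simp only [slicePt, Complex.add_re, Complex.add_im, Complex.sub_re, Complex.sub_im,
    Complex.mul_re, Complex.mul_im, Complex.ofReal_re, Complex.ofReal_im, sq]
  module

end Norm

/-! ### The complexified algebra -/

section Complexified

variable {A : Type*} [NormedNonAssocRing A] [NormedSpace ℝ A]

theorem cMul_ofC [IsScalarTower ℝ A A] (w : ℂ) (p : A × A) :
    cMul (ofC w) p = (w.re • p.1 - w.im • p.2, w.re • p.2 + w.im • p.1) := by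
  simp [cMul, ofC, smul_mul_assoc]

theorem cMul_ofC_ofC_mul [IsScalarTower ℝ A A] (w v : ℂ) (p : A × A) :
    cMul (ofC (w * v)) p = cMul (ofC w) (cMul (ofC v) p) := by
  simp only [cMul_ofC, Complex.mul_re, Complex.mul_im]
  ext <;> module

theorem cMul_ofC_assoc [IsScalarTower ℝ A A] (w : ℂ) (p q : A × A) :
    cMul (cMul (ofC w) p) q = cMul (ofC w) (cMul p q) := by
  simp only [cMul_ofC]
  simp only [cMul, add_mul, sub_mul, smul_mul_assoc, smul_sub, smul_add]
  ext <;> simp only <;> abel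

/-- The embedding of `A` into its complexification that intertwines left multiplication by `J` with
multiplication by `ι`. -/
def slift (J a : A) : A × A := (a, -(J * a))

variable [StarRing A] [IsScalarTower ℝ A A] [SMulCommClass ℝ A A] [IsAlternativeRing A]

/-- The evaluation at `J` is complex linear for the complex structure of left multiplication by
`J`. -/
theorem cEval_cMul_ofC {J : A} (hJ : J ∈ imagUnits A) (w : ℂ) (p : A × A) :
    cEval J (cMul (ofC w) p) = slicePt J w * cEval J p := by
  rw [cMul_ofC]
  simp only [cEval, slicePt, mul_add, add_mul, smul_mul_assoc, mul_smul_comm, one_mul,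
    mul_mul_of_mem_imagUnits hJ]
  module

theorem slift_slicePt_mul {J : A} (hJ : J ∈ imagUnits A) (w : ℂ) (a : A) :
    slift J (slicePt J w * a) = cMul (ofC w) (slift J a) := by
  rw [cMul_ofC]
  simp only [slift, slicePt, mul_add, add_mul, smul_mul_assoc, mul_smul_comm, one_mul,
    mul_mul_of_mem_imagUnits hJ]
  ext <;> simp only <;> module

theorem cEval_slift {J : A} (hJ : J ∈ imagUnits A) (a : A) :
    cEval J (slift J a) = (2 : ℝ) • a := by
  simp only [cEval, slift, mul_neg, mul_mul_of_mem_imagUnits hJ]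
  module

/-- An element of the complexified algebra is determined by its values at `J` and `-J`. -/
theorem eq_of_cEval {J : A} (hJ : J ∈ imagUnits A) (p : A × A) :
    p = (1 / 2 : ℝ) • (cEval J p + cEval (-J) p, -(J * (cEval J p - cEval (-J) p))) := by
  simp only [cEval, neg_mul, add_sub_add_left_eq_sub, sub_neg_eq_add, mul_add,
    mul_mul_of_mem_imagUnits hJ]
  ext <;> simp only [Prod.smul_mk] <;> module

variable [StarModule ℝ A] [Nontrivial A]

theorem cMul_slicePt {J : A} (hJ : J ∈ imagUnits A) (u v u' v' : ℂ) :
    cMul (slicePt J u, slicePt J v) (slicePt J u', slicePt J v') =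
      (slicePt J (u * u' - v * v'), slicePt J (u * v' + v * u')) := by
  have h : ∀ a b : ℂ, slicePt J (a + b) = slicePt J a + slicePt J b := fun a b => by
    simp only [slicePt, Complex.add_re, Complex.add_im, add_smul]; abel
  simp only [cMul, slicePt_sub, slicePt_mul hJ, h]

/-- The pairs with entries in `ℂ_J` form a copy of `ℂ ⊗ ℂ`, on which `u + ι v ↦ u + i v` is
multiplicative. -/
theorem cPow_slicePt {J : A} (hJ : J ∈ imagUnits A) {u v c : ℂ} (h : u + I * v = c) (n : ℕ) :
    ∃ u' v' : ℂ, cPow (slicePt J u, slicePt J v) n = (slicePt J u', slicePt J v') ∧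
      u' + I * v' = c ^ n := by
  induction n with
  | zero => exact ⟨1, 0, by simp [cPow, slicePt], by simp⟩
  | succ n ih =>
    obtain ⟨u', v', h1, h2⟩ := ih
    refine ⟨u' * u - v' * v, u' * v + v' * u, ?_, ?_⟩
    · rw [cPow, h1, cMul_slicePt hJ]
    · rw [pow_succ, ← h2, ← h]
      linear_combination (-(v' * v)) * Complex.I_mul_I

theorem cEval_cMul_slicePt_ofA {J : A} (hJ : J ∈ imagUnits A) (u v : ℂ) (a : A) :
    cEval J (cMul (slicePt J u, slicePt J v) (ofA a)) = slicePt J (u + I * v) * a := by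
  simp only [cEval, cMul, ofA, mul_zero, sub_zero, zero_add]
  have h : J * (slicePt J v * a) = slicePt J (I * v) * a := by
    rw [← slicePt_mul_mul hJ]
    simp [slicePt]
  rw [h, ← add_mul]
  congr 1
  simp only [slicePt, Complex.add_re, Complex.add_im]
  module

/-- On the plane `ℂ_J` the slice powers of `x - y` are the ordinary powers. -/
theorem cEval_binomStem {J : A} (hJ : J ∈ imagUnits A) {w z : ℂ}
    (hz' : z ≠ conj w) (n : ℤ) (a : A) :
    cEval J (cMul (binomStem (slicePt J w) n z) (ofA a)) = slicePt J ((z - w) ^ n) * a := by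
  have hx : ∀ w : ℂ, ofC z - ofA (slicePt J w) =
      (slicePt J ((z.re : ℂ) - w), slicePt J (z.im : ℂ)) := fun w => by
    simp [ofC, ofA, slicePt_sub, slicePt_ofReal]
  have hval : ∀ w : ℂ, ((z.re : ℂ) - w) + I * z.im = z - w := fun w => by
    conv_rhs => rw [← Complex.re_add_im z]
    ring
  cases n with
  | ofNat n =>
    rw [binomStem, hx]
    obtain ⟨u, v, h1, h2⟩ := cPow_slicePt hJ (hval w) n
    rw [h1, cEval_cMul_slicePt_ofA hJ, h2, Int.ofNat_eq_natCast, zpow_natCast]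
  | negSucc n =>
    rw [binomStem, star_slicePt hJ, slicePt_neg, hx]
    set d := (deltaStem (slicePt J w) z)⁻¹ with hd
    have h0 : ofC d = (slicePt J (d.re : ℂ), slicePt J (d.im : ℂ)) := by
      simp [ofC, slicePt_ofReal]
    have h3 : ((d.re : ℂ) * ((z.re : ℂ) - conj w) - d.im * z.im) +
        I * (d.re * z.im + d.im * ((z.re : ℂ) - conj w)) = (z - w)⁻¹ := by
      have : d * (z - conj w) = (z - w)⁻¹ := by
        rw [hd, deltaStem_slicePt hJ, mul_inv, mul_assoc,
          inv_mul_cancel₀ (sub_ne_zero.2 hz'), mul_one]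
      rw [← this, ← hval (conj w)]
      conv_rhs => rw [← Complex.re_add_im d]
      linear_combination (-(d.im * z.im : ℂ)) * Complex.I_mul_I
    rw [h0, cMul_slicePt hJ]
    obtain ⟨u, v, h1, h2⟩ := cPow_slicePt hJ h3 (n + 1)
    rw [h1, cEval_cMul_slicePt_ofA hJ, h2, zpow_negSucc, inv_pow]

end Complexified

section SphericalStem

variable {A : Type*} [NormedNonAssocRing A] [NormedSpace ℝ A] [StarRing A] [IsScalarTower ℝ A A]

theorem sphericalStem_even (y : A) (k : ℤ) (z : ℂ) (c : A) :
    cMul (sphericalStem y (2 * k) z) (ofA c) = cMul (ofC (deltaStem y z ^ k)) (ofA c) := by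
  rw [sphericalStem, if_pos (even_two_mul k)]
  simp

theorem sphericalStem_odd (y : A) (k : ℤ) (z : ℂ) (c : A) :
    cMul (sphericalStem y (2 * k + 1) z) (ofA c) =
      cMul (ofC (deltaStem y z ^ k)) (cMul (ofC z - ofA y) (ofA c)) := by
  rw [sphericalStem, if_neg (by simp), cMul_ofC_assoc]
  congr 4
  omega

/-- Multiplication by `Δ_y^m` shifts the index of `𝒮_{y,n}` by `2m`. -/
theorem sphericalStem_sub (y : A) {z : ℂ} (hz : deltaStem y z ≠ 0) (m : ℕ) (n : ℤ) (c : A) :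
    cMul (ofC (deltaStem y z ^ m)) (cMul (sphericalStem y (n - 2 * m) z) (ofA c)) =
      cMul (sphericalStem y n z) (ofA c) := by
  have key : ∀ k : ℤ, deltaStem y z ^ m * deltaStem y z ^ (k - m) = deltaStem y z ^ k := fun k => by
    rw [← zpow_natCast, ← zpow_add₀ hz]; congr 1; ring
  rcases Int.even_or_odd' n with ⟨k, rfl | rfl⟩
  · rw [← mul_sub, sphericalStem_even, sphericalStem_even, ← cMul_ofC_ofC_mul, key]
  · rw [show 2 * k + 1 - 2 * (m : ℤ) = 2 * (k - m) + 1 by ring, sphericalStem_odd,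
      sphericalStem_odd, ← cMul_ofC_ofC_mul, key]

/-- The functions `𝒮_{y,n} · c` are slice functions. -/
theorem cEval_sphericalStem_conj [Nontrivial A] [StarModule ℝ A] [SMulCommClass ℝ A A]
    (J y : A) (n : ℤ) (z : ℂ) (c : A) :
    cEval (-J) (cMul (sphericalStem y n (conj z)) (ofA c)) =
      cEval J (cMul (sphericalStem y n z) (ofA c)) := by
  have hd : ∀ k : ℤ, deltaStem y (conj z) ^ k = conj (deltaStem y z ^ k) := fun k => by
    rw [deltaStem_conj, map_zpow₀]
  rcases Int.even_or_odd' n with ⟨k, rfl | rfl⟩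
  · simp only [sphericalStem_even, cMul_ofC, hd]
    generalize deltaStem y z ^ k = d
    simp [cEval, ofA]
  · simp only [sphericalStem_odd, cMul_ofC, hd]
    generalize deltaStem y z ^ k = d
    simp [cEval, cMul, ofC, ofA]
    rw [← mul_neg, neg_add, neg_neg, neg_neg]

end SphericalStem

/-! ### Power series at a removable singularity -/

section PowerSeries

variable {E : Type*} [NormedAddCommGroup E] [NormedSpace ℂ E]

/-- Riemann's removable singularity theorem, in terms of power series. -/
theorem exists_hasSum_of_isBigO_one [CompleteSpace E] {g : ℂ → E} {c : ℂ}
    (hd : ∀ᶠ z in 𝓝[≠] c, DifferentiableAt ℂ g z) (hb : g =O[𝓝[≠] c] (fun _ => (1 : ℝ))) :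
    ∃ e : ℕ → E, ∃ r : ℝ, 0 < r ∧ ∀ z, z ≠ c → ‖z - c‖ < r →
      HasSum (fun n : ℕ => (z - c) ^ n • e n) (g z) := by
  obtain ⟨C, hC⟩ := hb.bound
  obtain ⟨r, hr, hball⟩ := Metric.mem_nhdsWithin_iff.1 (hd.and hC)
  have hd' : DifferentiableOn ℂ g (Metric.ball c r \ {c}) := fun z hz =>
    (hball ⟨hz.1, hz.2⟩).1.differentiableWithinAt
  have hb' : BddAbove (norm ∘ g '' (Metric.ball c r \ {c})) := by
    refine ⟨C, ?_⟩
    rintro _ ⟨z, hz, rfl⟩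
    simpa using (hball ⟨hz.1, hz.2⟩).2
  have h := Complex.differentiableOn_update_limUnder_of_bddAbove
    (Metric.ball_mem_nhds c hr) hd' hb'
  have hr2 : (0 : ℝ) < r / 2 := by positivity
  lift r / 2 to NNReal using hr2.le with R hR
  have h' := (h.mono (Metric.closedBall_subset_ball (by rw [hR]; linarith))).hasFPowerSeriesOnBall
    (R := R) (by exact_mod_cast hr2)
  refine ⟨fun n => (cauchyPowerSeries (Function.update g c (limUnder (𝓝[≠] c) g)) c R).coeff n,
    R, hr2, fun z hz hzR => ?_⟩
  have h2 := h'.hasSum_sub (y := z) (by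
    rw [Metric.mem_eball, edist_dist, dist_eq_norm]
    exact (ENNReal.ofReal_lt_iff_lt_toReal (norm_nonneg _) ENNReal.coe_ne_top).2 hzR)
  rw [Function.update_of_ne hz] at h2
  simpa [FormalMultilinearSeries.apply_eq_pow_smul_coeff] using h2

/-- The sum of a power series is bounded near its centre; the value at the centre is irrelevant. -/
theorem isBigO_one_of_hasSum {g : ℂ → E} {c : ℂ} {e : ℕ → E} {r : ℝ} (hr : 0 < r)
    (h : ∀ z, z ≠ c → ‖z - c‖ < r → HasSum (fun n : ℕ => (z - c) ^ n • e n) (g z)) :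
    g =O[𝓝[≠] c] (fun _ => (1 : ℝ)) := by
  obtain ⟨C, hC⟩ : ∃ C, ∀ n : ℕ, (r / 2) ^ n * ‖e n‖ ≤ C := by
    have h1 := h (c + (r / 2 : ℝ)) (by simp [hr.ne'])
      (by simp only [add_sub_cancel_left, norm_real, Real.norm_eq_abs]
          rw [abs_of_pos (by positivity)]; linarith)
    obtain ⟨C, hC⟩ := h1.summable.tendsto_atTop_zero.norm.bddAbove_range
    refine ⟨C, fun n => ?_⟩
    have := hC ⟨n, rfl⟩
    simpa [norm_smul, abs_of_pos hr] using this
  refine IsBigO.of_bound (C * 2) ?_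
  rw [eventually_nhdsWithin_iff]
  filter_upwards [Metric.ball_mem_nhds c (show 0 < r / 4 by positivity)] with z hz hzc
  rw [Metric.mem_ball, dist_eq_norm] at hz
  simp only [norm_one, mul_one]
  refine (h z hzc (by linarith)).norm_le_of_bounded (hasSum_geometric_two.mul_left C) fun n => ?_
  rw [norm_smul, norm_pow]
  calc ‖z - c‖ ^ n * ‖e n‖ ≤ (r / 4) ^ n * ‖e n‖ := by gcongr
    _ = ((r / 2) ^ n * ‖e n‖) * (1 / 2) ^ n := by
        rw [show r / 4 = r / 2 * (1 / 2) by ring, mul_pow]; ring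
    _ ≤ C * (1 / 2) ^ n := by gcongr; exact hC n

end PowerSeries

/-! ### Complex coordinates on the complexified algebra -/

section Coordinates

variable {A : Type*} [NormedNonAssocRing A] [NormedSpace ℝ A] [FiniteDimensional ℝ A]

variable (A) in
/-- Complex coordinates on `A ⊗ ℂ`, given by a real basis of `A`. They make the complexified
algebra, encoded as `A × A`, a complex Banach space. -/
noncomputable def coords : (A × A) ≃L[ℝ] (Fin (Module.finrank ℝ A) → ℂ) :=
  LinearEquiv.toContinuousLinearEquiv
    { toFun := fun p i => ⟨(Module.finBasis ℝ A).equivFun p.1 i,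
        (Module.finBasis ℝ A).equivFun p.2 i⟩
      map_add' := fun p q => by ext i; apply Complex.ext <;> simp
      map_smul' := fun r p => by ext i; apply Complex.ext <;> simp
      invFun := fun v => ((Module.finBasis ℝ A).equivFun.symm fun i => (v i).re,
        (Module.finBasis ℝ A).equivFun.symm fun i => (v i).im)
      left_inv := fun p => by simp
      right_inv := fun v => by
        ext i
        apply Complex.ext <;> simp only [LinearEquiv.apply_symm_apply] }

theorem coords_apply (p : A × A) (i : Fin (Module.finrank ℝ A)) :
    coords A p i = ⟨(Module.finBasis ℝ A).equivFun p.1 i,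
      (Module.finBasis ℝ A).equivFun p.2 i⟩ := rfl

theorem coords_cMul_ofC [IsScalarTower ℝ A A] (w : ℂ) (p : A × A) :
    coords A (cMul (ofC w) p) = w • coords A p := by
  ext i
  rw [cMul_ofC]
  apply Complex.ext <;> simp [coords_apply, Complex.mul_re, Complex.mul_im]

theorem coords_symm_smul [IsScalarTower ℝ A A] (w : ℂ) (v : Fin (Module.finrank ℝ A) → ℂ) :
    (coords A).symm (w • v) = cMul (ofC w) ((coords A).symm v) := by
  rw [ContinuousLinearEquiv.symm_apply_eq, coords_cMul_ofC, ContinuousLinearEquiv.apply_symm_apply]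

theorem coords_conj (p : A × A) : coords A (p.1, -p.2) = star (coords A p) := by
  ext i
  apply Complex.ext <;> simp [coords_apply]

/-- Left multiplication by `a` as a continuous linear map. -/
noncomputable def mulL [SMulCommClass ℝ A A] (a : A) : A →L[ℝ] A :=
  LinearMap.toContinuousLinearMap (LinearMap.mulLeft ℝ a)

/-- The evaluation `x + ι y ↦ x + J y` as a continuous linear map. -/
noncomputable def cEvalL [SMulCommClass ℝ A A] (J : A) : A × A →L[ℝ] A :=
  ContinuousLinearMap.fst ℝ A A + (mulL J).comp (ContinuousLinearMap.snd ℝ A A)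

/-- The map `slift` as a continuous linear map. -/
noncomputable def sliftL [SMulCommClass ℝ A A] (J : A) : A →L[ℝ] A × A :=
  (ContinuousLinearMap.id ℝ A).prod (-(mulL J))

variable [SMulCommClass ℝ A A]

@[simp] theorem mulL_apply (a x : A) : mulL a x = a * x := rfl

@[simp] theorem cEvalL_apply (J : A) (p : A × A) : cEvalL J p = cEval J p := rfl

@[simp] theorem sliftL_apply (J a : A) : sliftL J a = slift J a := rfl

variable [IsScalarTower ℝ A A]

/-- A solution of `∂F/∂α + ι ∂F/∂β = 0` is holomorphic, and so is its image under a real linear map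
that commutes with `ι`. -/
theorem differentiableAt_coords {F : ℂ → A × A} {z : ℂ} (hd : DifferentiableAt ℝ F z)
    (hF : fderiv ℝ F z 1 + cMul (ofC Complex.I) (fderiv ℝ F z Complex.I) = 0)
    (M : A × A →L[ℝ] A × A) (hM : ∀ p, M (cMul (ofC I) p) = cMul (ofC I) (M p)) :
    DifferentiableAt ℂ (fun z => coords A (M (F z))) z := by
  rw [differentiableAt_complex_iff_differentiableAt_real]
  set L : A × A →L[ℝ] (Fin (Module.finrank ℝ A) → ℂ) :=
    (coords A : A × A →L[ℝ] (Fin (Module.finrank ℝ A) → ℂ)).comp M with hL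
  have h1 : HasFDerivAt (fun z => coords A (M (F z))) (L.comp (fderiv ℝ F z)) z :=
    L.hasFDerivAt.comp z hd.hasFDerivAt
  refine ⟨h1.differentiableAt, ?_⟩
  rw [h1.fderiv]
  have h2 : fderiv ℝ F z I = cMul (ofC I) (fderiv ℝ F z 1) := by
    rw [eq_neg_of_add_eq_zero_left hF]
    generalize fderiv ℝ F z I = p
    simp [cMul_ofC]
  simp only [hL, ContinuousLinearMap.comp_apply, h2, hM]
  exact coords_cMul_ofC _ _

end Coordinates

/-! ### Laurent expansions on a plane `ℂ_J` -/

section Laurent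

variable {A : Type*} [NormedNonAssocRing A] [NormedSpace ℝ A] [FiniteDimensional ℝ A]
  [StarRing A] [IsScalarTower ℝ A A] [SMulCommClass ℝ A A]

/-- The stem function `F` multiplied by `(z - z₀)^m`. -/
noncomputable def mulPow (z₀ : ℂ) (F : ℂ → A × A) (m : ℕ) (z : ℂ) : A × A :=
  cMul (ofC ((z - z₀) ^ m)) (F z)

/-- In a punctured neighbourhood of `z₀`, the function `F` is real differentiable and satisfies the
Cauchy-Riemann equation `∂F/∂α + ι ∂F/∂β = 0`. -/
def HolNear (z₀ : ℂ) (F : ℂ → A × A) : Prop :=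
  ∀ᶠ z in 𝓝[≠] z₀, DifferentiableAt ℝ F z ∧
    fderiv ℝ F z 1 + cMul (ofC Complex.I) (fderiv ℝ F z Complex.I) = 0

variable [IsAlternativeRing A] {z₀ : ℂ} {F : ℂ → A × A} {J : A}

theorem isBigO_one_cMul_ofC {φ : ℂ → ℂ} (hφ : ContinuousAt φ z₀) {G : ℂ → A × A}
    (h : G =O[𝓝[≠] z₀] (fun _ => (1 : ℝ))) :
    (fun z => cMul (ofC (φ z)) (G z)) =O[𝓝[≠] z₀] (fun _ => (1 : ℝ)) := by
  have h1 : (fun z => coords A (G z)) =O[𝓝[≠] z₀] (fun _ => (1 : ℝ)) :=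
    ((coords A).toContinuousLinearMap.isBigO_comp _ _).trans h
  have h2 : φ =O[𝓝[≠] z₀] (fun _ => (1 : ℝ)) := (hφ.isBigO_one ℝ).mono nhdsWithin_le_nhds
  have h3 := (coords A).symm.toContinuousLinearMap.isBigO_comp
    (fun z => φ z • coords A (G z)) (𝓝[≠] z₀)
  refine IsBigO.trans (h3.congr_left fun z => ?_) (by simpa using h2.smul h1)
  simp only [ContinuousLinearEquiv.coe_coe, coords_symm_smul,
    ContinuousLinearEquiv.symm_apply_apply]

theorem isBigO_one_mulPow_succ {m : ℕ}
    (h : mulPow z₀ F m =O[𝓝[≠] z₀] (fun _ => (1 : ℝ))) :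
    mulPow z₀ F (m + 1) =O[𝓝[≠] z₀] (fun _ => (1 : ℝ)) := by
  refine (isBigO_one_cMul_ofC (φ := fun z => z - z₀) (by fun_prop) h).congr_left fun z => ?_
  simp only [mulPow]
  rw [← cMul_ofC_ofC_mul, pow_succ']

theorem isBigO_one_cEval_of_isBigO_one {m : ℕ} (a : A)
    (h : mulPow z₀ F m =O[𝓝[≠] z₀] (fun _ => (1 : ℝ))) :
    (fun z => cEval a (mulPow z₀ F m z)) =O[𝓝[≠] z₀] (fun _ => (1 : ℝ)) :=
  ((cEvalL a).isBigO_comp _ _).trans h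

theorem isBigO_one_of_isBigO_one_cEval (hJ : J ∈ imagUnits A) {m : ℕ}
    (h : (fun z => cEval J (mulPow z₀ F m z)) =O[𝓝[≠] z₀] (fun _ => (1 : ℝ)))
    (h' : (fun z => cEval (-J) (mulPow z₀ F m z)) =O[𝓝[≠] z₀] (fun _ => (1 : ℝ))) :
    mulPow z₀ F m =O[𝓝[≠] z₀] (fun _ => (1 : ℝ)) := by
  have h1 := ((h.add h').prod_left (((mulL (-J)).isBigO_comp _ _).trans (h.sub h'))).const_smul_left
    (1 / 2 : ℝ)
  refine h1.congr_left fun z => ?_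
  conv_rhs => rw [eq_of_cEval hJ (mulPow z₀ F m z)]
  simp

theorem isBigO_one_cEval_succ (hJ : J ∈ imagUnits A) {m : ℕ}
    (h : (fun z => cEval J (mulPow z₀ F m z)) =O[𝓝[≠] z₀] (fun _ => (1 : ℝ))) :
    (fun z => cEval J (mulPow z₀ F (m + 1) z)) =O[𝓝[≠] z₀] (fun _ => (1 : ℝ)) := by
  have h1 : mulPow z₀ (fun z => slift J (cEval J (F z))) m =O[𝓝[≠] z₀] (fun _ => (1 : ℝ)) := by
    refine (((sliftL J).isBigO_comp _ _).trans h).congr_left fun z => ?_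
    simp only [mulPow, sliftL_apply, cEval_cMul_ofC hJ, slift_slicePt_mul hJ]
  have h2 := (isBigO_one_cEval_of_isBigO_one J (isBigO_one_mulPow_succ h1)).const_smul_left
    (1 / 2 : ℝ)
  refine h2.congr_left fun z => ?_
  simp only [mulPow, cEval_cMul_ofC hJ, cEval_slift hJ, Pi.smul_apply]
  rw [mul_smul_comm, smul_smul]
  norm_num

/-- A pole of order at most `m` of the restriction to `ℂ_J` gives a Laurent expansion whose
principal part has at most `m` terms. -/
theorem exists_hasSum_slicePt_zpow (hJ : J ∈ imagUnits A) (hF : HolNear z₀ F) {m : ℕ}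
    (h : (fun z => cEval J (mulPow z₀ F m z)) =O[𝓝[≠] z₀] (fun _ => (1 : ℝ))) :
    ∃ a : ℤ → A, (∀ k : ℕ, m < k → a (-(k : ℤ)) = 0) ∧ ∃ r : ℝ, 0 < r ∧
      ∀ z, z ≠ z₀ → ‖z - z₀‖ < r →
        HasSum (fun n : ℤ => slicePt J ((z - z₀) ^ n) * a n) (cEval J (F z)) := by
  set g : ℂ → (Fin (Module.finrank ℝ A) → ℂ) :=
    fun z => (z - z₀) ^ m • coords A (slift J (cEval J (F z))) with hg
  have hgG : ∀ z, g z = coords A (slift J (cEval J (mulPow z₀ F m z))) := fun z => by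
    simp only [hg, mulPow, cEval_cMul_ofC hJ, slift_slicePt_mul hJ, coords_cMul_ofC]
  have hd : ∀ᶠ z in 𝓝[≠] z₀, DifferentiableAt ℂ g z := by
    filter_upwards [hF] with z hz
    refine DifferentiableAt.fun_smul (by fun_prop) ?_
    exact differentiableAt_coords hz.1 hz.2 ((sliftL J).comp (cEvalL J)) fun p => by
      simp only [ContinuousLinearMap.comp_apply, cEvalL_apply, sliftL_apply, cEval_cMul_ofC hJ,
        slift_slicePt_mul hJ]
  have hb : g =O[𝓝[≠] z₀] (fun _ => (1 : ℝ)) := by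
    refine IsBigO.congr_left ?_ fun z => (hgG z).symm
    exact (((coords A).toContinuousLinearMap.comp (sliftL J)).isBigO_comp _ _).trans h
  obtain ⟨e, r, hr, hs⟩ := exists_hasSum_of_isBigO_one hd hb
  set a' : ℕ → A := fun n => (1 / 2 : ℝ) • cEval J ((coords A).symm (e n)) with ha'
  have hi : Function.Injective fun n : ℕ => (n : ℤ) - m := fun a b hab => by
    simp only at hab; omega
  refine ⟨fun k => if -(m : ℤ) ≤ k then a' (k + m).toNat else 0, fun k hk => ?_, r, hr,
    fun z hz hzr => ?_⟩
  · exact if_neg (by omega)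
  · rw [← hi.hasSum_iff]
    · have h1 := ((((1 / 2 : ℝ) • mulL (slicePt J ((z - z₀) ^ (-(m : ℤ))))).comp
        (cEvalL J)).comp (coords A).symm.toContinuousLinearMap).hasSum (hs z hz hzr)
      rw [hgG] at h1
      have hz' : z - z₀ ≠ 0 := sub_ne_zero.2 hz
      convert h1 using 1
      · ext n
        simp [ha', coords_symm_smul, cEval_cMul_ofC hJ, slicePt_mul_mul hJ, mul_smul_comm]
        congr 3
        rw [zpow_sub₀ hz', zpow_natCast, zpow_natCast, div_eq_inv_mul]
      · simp [cEval_slift hJ, mulPow, cEval_cMul_ofC hJ, slicePt_mul_mul hJ,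
          smul_smul]
        rw [inv_mul_cancel₀ (pow_ne_zero _ hz'), slicePt_one, one_mul]
    · intro x hx
      have hxm : ¬ -(m : ℤ) ≤ x := fun hxm => hx ⟨(x + m).toNat, by simp only; omega⟩
      simp only [if_neg hxm, mul_zero]

/-- A Laurent expansion on `ℂ_J` whose principal part has at most `m` terms forces a pole of order at
most `m`. -/
theorem isBigO_one_cEval_of_hasSum (hJ : J ∈ imagUnits A) {m : ℕ} {a : ℤ → A}
    (ha : ∀ k : ℕ, m < k → a (-(k : ℤ)) = 0) {r : ℝ} (hr : 0 < r)
    (h : ∀ z, z ≠ z₀ → ‖z - z₀‖ < r →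
        HasSum (fun n : ℤ => slicePt J ((z - z₀) ^ n) * a n) (cEval J (F z))) :
    (fun z => cEval J (mulPow z₀ F m z)) =O[𝓝[≠] z₀] (fun _ => (1 : ℝ)) := by
  have hi : Function.Injective fun n : ℕ => (n : ℤ) - m := fun a b hab => by
    simp only at hab; omega
  have hs : ∀ z, z ≠ z₀ → ‖z - z₀‖ < r →
      HasSum (fun n : ℕ => (z - z₀) ^ n • coords A (slift J (a ((n : ℤ) - m))))
        (coords A (slift J (cEval J (mulPow z₀ F m z)))) := by
    intro z hz hzr
    have hz' : z - z₀ ≠ 0 := sub_ne_zero.2 hz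
    have h1 := h z hz hzr
    rw [← hi.hasSum_iff] at h1
    · have h2 := (((coords A).toContinuousLinearMap.comp (sliftL J)).comp
        (mulL (slicePt J ((z - z₀) ^ m)))).hasSum h1
      convert h2 using 1
      · ext1 n
        simp only [Function.comp_apply, ContinuousLinearMap.comp_apply, mulL_apply, sliftL_apply,
          slicePt_mul_mul hJ, slift_slicePt_mul hJ, ContinuousLinearEquiv.coe_coe,
          coords_cMul_ofC]
        rw [← zpow_natCast _ m, ← zpow_add₀ hz', add_sub_cancel, zpow_natCast]
      · simp [mulPow, cEval_cMul_ofC hJ]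
    · intro x hx
      have hxm : x < -(m : ℤ) := by
        by_contra hxm
        exact hx ⟨(x + m).toNat, by simp only; omega⟩
      have := ha (-x).toNat (by omega)
      rw [show -(((-x).toNat : ℕ) : ℤ) = x by omega] at this
      rw [this, mul_zero]
  have hb := isBigO_one_of_hasSum hr hs
  have h3 := ((((1 / 2 : ℝ) • cEvalL J).comp (coords A).symm.toContinuousLinearMap).isBigO_comp
    (fun z => coords A (slift J (cEval J (mulPow z₀ F m z)))) (𝓝[≠] z₀)).trans hb
  refine h3.congr_left fun z => ?_
  simp [cEval_slift hJ, smul_smul]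

end Laurent

/-! ### A chart in which `Δ_y` is the coordinate -/

section Chart

/-- The local inverse of `z ↦ (z - z₀) (z - conj z₀)` with values near `z₀`. -/
noncomputable def cassiniChart (z₀ w : ℂ) : ℂ :=
  z₀.re + I * z₀.im * (1 - w / (z₀.im : ℂ) ^ 2) ^ (2⁻¹ : ℂ)

variable {z₀ : ℂ}

theorem mul_cassiniChart (h₀ : 0 < z₀.im) (w : ℂ) :
    (cassiniChart z₀ w - z₀) * (cassiniChart z₀ w - conj z₀) = w := by
  have hb : (z₀.im : ℂ) ≠ 0 := by exact_mod_cast h₀.ne'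
  have hs := Complex.cpow_nat_inv_pow (1 - w / (z₀.im : ℂ) ^ 2) (n := 2) two_ne_zero
  rw [Nat.cast_ofNat] at hs
  have h1 : conj z₀ = z₀.re - I * z₀.im := by
    apply Complex.ext <;> simp
  have h2 : z₀ = z₀.re + I * z₀.im := by
    apply Complex.ext <;> simp
  rw [h1]
  conv_lhs => enter [1, 2]; rw [h2]
  rw [cassiniChart]
  generalize (1 - w / (z₀.im : ℂ) ^ 2) ^ (2⁻¹ : ℂ) = s at *
  have h3 : w = (z₀.im : ℂ) ^ 2 * (1 - s ^ 2) := by rw [hs]; field_simp; ring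
  rw [h3]
  linear_combination ((z₀.im : ℂ) ^ 2 * (s ^ 2 - 1)) * Complex.I_sq

theorem cassiniChart_mul (h₀ : 0 < z₀.im) {z : ℂ} (hz : 0 < z.im) :
    cassiniChart z₀ ((z - z₀) * (z - conj z₀)) = z := by
  have hb : (z₀.im : ℂ) ≠ 0 := by exact_mod_cast h₀.ne'
  set u : ℂ := (z - z₀.re) / (I * z₀.im) with hu
  have h1 : conj z₀ = z₀.re - I * z₀.im := by
    apply Complex.ext <;> simp
  have h2 : z₀ = z₀.re + I * z₀.im := by
    apply Complex.ext <;> simp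
  have h3 : z - z₀.re = u * (I * z₀.im) := by
    rw [hu, div_mul_cancel₀ _ (mul_ne_zero Complex.I_ne_zero hb)]
  have hure : 0 < u.re := by
    have := congrArg Complex.im h3
    simp at this
    rw [this] at hz
    exact pos_of_mul_pos_left hz h₀.le
  have h4 : 1 - (z - z₀) * (z - conj z₀) / (z₀.im : ℂ) ^ 2 = u ^ 2 := by
    have h5 : (z - z₀) * (z - conj z₀) = (z₀.im : ℂ) ^ 2 * (1 - u ^ 2) := by
      rw [h1]
      conv_lhs => enter [1, 2]; rw [h2]
      linear_combination ((z - z₀.re) + u * (I * z₀.im)) * h3 +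
        ((z₀.im : ℂ) ^ 2 * (u ^ 2 - 1)) * Complex.I_sq
    rw [h5]
    field_simp
    ring
  rw [cassiniChart, h4, Complex.sq_cpow_two_inv hure]
  linear_combination -h3

theorem one_sub_div_mem_slitPlane {b : ℝ} {w : ℂ} (hw : ‖w‖ < b ^ 2) :
    1 - w / (b : ℂ) ^ 2 ∈ Complex.slitPlane := by
  refine Complex.mem_slitPlane_of_norm_lt_one (z := -(w / (b : ℂ) ^ 2)) ?_ |> fun h => by
    rwa [← sub_eq_add_neg] at h
  have hb : 0 < b ^ 2 := (norm_nonneg _).trans_lt hw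
  rw [norm_neg, norm_div, norm_pow, norm_real, Real.norm_eq_abs, sq_abs, div_lt_one hb]
  exact hw

theorem differentiableAt_cassiniChart {w : ℂ} (hw : ‖w‖ < z₀.im ^ 2) :
    DifferentiableAt ℂ (cassiniChart z₀) w := by
  unfold cassiniChart
  refine (differentiableAt_const _).add ((differentiableAt_const _).mul ?_)
  exact DifferentiableAt.cpow_const (by fun_prop) (one_sub_div_mem_slitPlane hw)

theorem cassiniChart_zero : cassiniChart z₀ 0 = z₀ := by
  apply Complex.ext <;> simp [cassiniChart]

theorem tendsto_cassiniChart (h₀ : 0 < z₀.im) :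
    Tendsto (cassiniChart z₀) (𝓝[≠] 0) (𝓝[≠] z₀) := by
  refine tendsto_nhdsWithin_iff.2 ⟨?_, ?_⟩
  · have h := (differentiableAt_cassiniChart (z₀ := z₀) (w := 0)
      (by simpa using pow_pos h₀ 2)).continuousAt.tendsto
    rw [cassiniChart_zero] at h
    exact h.mono_left nhdsWithin_le_nhds
  · filter_upwards [self_mem_nhdsWithin] with w hw hw'
    have h := mul_cassiniChart h₀ w
    rw [Set.mem_singleton_iff.1 hw', sub_self, zero_mul] at h
    exact hw h.symm

theorem conj_cassiniChart {w : ℂ} (hw : ‖w‖ < z₀.im ^ 2) :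
    conj (cassiniChart z₀ (conj w) - z₀.re) = -(cassiniChart z₀ w - z₀.re) := by
  have h : conj ((1 - conj w / (z₀.im : ℂ) ^ 2) ^ (2⁻¹ : ℂ)) =
      (1 - w / (z₀.im : ℂ) ^ 2) ^ (2⁻¹ : ℂ) := by
    have h1 := Complex.cpow_conj (1 - w / (z₀.im : ℂ) ^ 2) 2⁻¹
      (Complex.slitPlane_arg_ne_pi (one_sub_div_mem_slitPlane hw))
    simp only [map_inv₀, map_ofNat, map_sub, map_one, map_div₀, map_pow, Complex.conj_ofReal] at h1
    exact h1.symm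
  simp only [cassiniChart, add_sub_cancel_left, map_mul, h, Complex.conj_I, Complex.conj_ofReal]
  ring

/-- Cassini neighbourhoods, intersected with the upper half plane, shrink to `z₀`. -/
theorem exists_of_eventually_cassini (h₀ : 0 < z₀.im) {p : ℂ → Prop} (hp : ∀ᶠ z in 𝓝[≠] z₀, p z) :
    ∃ r : ℝ, 0 < r ∧ ∀ z : ℂ, 0 < z.im → 0 < ‖(z - z₀) * (z - conj z₀)‖ →
      ‖(z - z₀) * (z - conj z₀)‖ < r → p z := by
  have h := (tendsto_cassiniChart h₀).eventually hp
  obtain ⟨r, hr, hball⟩ := Metric.mem_nhdsWithin_iff.1 h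
  refine ⟨r, hr, fun z hz h1 h2 => ?_⟩
  have := hball (a := (z - z₀) * (z - conj z₀))
    ⟨mem_ball_zero_iff.2 h2, norm_pos_iff.1 h1⟩
  simp only [Set.mem_ofPred_eq, cassiniChart_mul h₀ hz] at this
  exact this

end Chart

/-! ### Spherical Laurent expansions -/

section Spherical

variable {A : Type*} [NormedNonAssocRing A] [NormedSpace ℝ A] [FiniteDimensional ℝ A]
  [StarRing A] [StarModule ℝ A] [IsScalarTower ℝ A A] [SMulCommClass ℝ A A] [Nontrivial A]
  [IsAlternativeRing A] {z₀ : ℂ} {F : ℂ → A × A} {J : A}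

theorem coords_fst_symm (v : Fin (Module.finrank ℝ A) → ℂ) :
    coords A (((coords A).symm v).1, 0) = (1 / 2 : ℝ) • (v + star v) := by
  obtain ⟨p, rfl⟩ := (coords A).surjective v
  rw [← coords_conj, ContinuousLinearEquiv.symm_apply_apply, ← map_add, ← map_smul]
  congr 1
  ext <;> simp only [Prod.fst_add, Prod.snd_add, Prod.smul_fst, Prod.smul_snd] <;> module

/-- The average of the Taylor series of `v(w)` and of `conj v(conj w)`. -/
theorem hasSum_coords_fst_symm {v : ℂ → (Fin (Module.finrank ℝ A) → ℂ)}
    {e : ℕ → (Fin (Module.finrank ℝ A) → ℂ)} {r : ℝ} {w : ℂ} (hw0 : w ≠ 0) (hr : ‖w‖ < r)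
    (hv : ∀ z, z ≠ 0 → ‖z - 0‖ < r → HasSum (fun n : ℕ => (z - 0) ^ n • e n) (v z)) :
    HasSum (fun n : ℕ => w ^ n • coords A (((coords A).symm (e n)).1, 0))
      ((1 / 2 : ℝ) • (v w + star (v (conj w)))) := by
  have h1 := hv w hw0 (by simpa using hr)
  have h2 := (hv (conj w) (by simpa using hw0) (by simpa using hr)).star
  refine ((h1.add h2).const_smul (1 / 2 : ℝ)).congr_fun fun n => ?_
  rw [coords_fst_symm]
  simp only [sub_zero, star_smul, star_pow]
  rw [smul_comm, smul_add]
  simp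

/-- Near `z₀`, the function `Δ^m F`, where `Δ = (z - z₀) (z - conj z₀)`, is a function `g` of
`w = Δ(z)`. It can be written as `P(w) + (z - Re z₀) Q(w)`, where the Taylor coefficients of `P` and
`Q` lie in `A`: the symmetrizations of `g(w)` and `g(w) / (z - Re z₀)` under
`v(w) ↦ conj v(conj w)` have this property. -/
theorem exists_hasSum_pow_mul_coords (h₀ : 0 < z₀.im) (hF : HolNear z₀ F)
    {m : ℕ} (h : mulPow z₀ F m =O[𝓝[≠] z₀] (fun _ => (1 : ℝ))) :
    ∃ (p q : ℕ → A) (r : ℝ), 0 < r ∧ ∀ z w : ℂ, 0 < z.im → w = (z - z₀) * (z - conj z₀) →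
      w ≠ 0 → ‖w‖ < r → ∃ s₁ s₂ : Fin (Module.finrank ℝ A) → ℂ,
        HasSum (fun n : ℕ => w ^ n • coords A (p n, 0)) s₁ ∧
        HasSum (fun n : ℕ => w ^ n • coords A (q n, 0)) s₂ ∧
        s₁ + (z - z₀.re) • s₂ = w ^ m • coords A (F z) := by
  have hχt := tendsto_cassiniChart h₀
  obtain ⟨χ, hχ⟩ : ∃ χ, χ = cassiniChart z₀ := ⟨_, rfl⟩
  rw [← hχ] at hχt
  have hχd : ∀ w : ℂ, ‖w‖ < z₀.im ^ 2 → DifferentiableAt ℂ χ w := fun w hw => by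
    rw [hχ]; exact differentiableAt_cassiniChart hw
  have hsmall : ∀ᶠ w : ℂ in 𝓝 0, ‖w‖ < z₀.im ^ 2 := by
    have := Metric.ball_mem_nhds (0 : ℂ) (show 0 < z₀.im ^ 2 by positivity)
    filter_upwards [this] with w hw
    simpa using hw
  have hχc : ContinuousAt χ 0 := (hχd 0 (by simpa using pow_pos h₀ 2)).continuousAt
  have hζ0 : χ 0 - z₀.re ≠ 0 := by
    rw [hχ, cassiniChart_zero]
    intro h
    have := congrArg Complex.im h
    simp [h₀.ne'] at this
  obtain ⟨g, hg⟩ : ∃ g : ℂ → (Fin (Module.finrank ℝ A) → ℂ),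
      g = fun w => w ^ m • coords A (F (χ w)) := ⟨_, rfl⟩
  have hgd : ∀ᶠ w in 𝓝[≠] 0, DifferentiableAt ℂ g w := by
    filter_upwards [hχt.eventually hF, nhdsWithin_le_nhds hsmall] with w hw hw'
    rw [hg]
    refine DifferentiableAt.fun_smul (by fun_prop) ?_
    exact (differentiableAt_coords hw.1 hw.2 (ContinuousLinearMap.id ℝ _) fun p => rfl).comp w
      (hχd w hw')
  have hgb : g =O[𝓝[≠] 0] (fun _ => (1 : ℝ)) := by
    have h1 := isBigO_one_cMul_ofC (φ := fun z => (z - conj z₀) ^ m) (by fun_prop) h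
    have h2 := (((coords A).toContinuousLinearMap.isBigO_comp _ _).trans h1).comp_tendsto hχt
    refine h2.congr_left fun w => ?_
    simp only [Function.comp_apply, mulPow, ContinuousLinearEquiv.coe_coe, ← cMul_ofC_ofC_mul,
      coords_cMul_ofC, hg]
    rw [← mul_pow, mul_comm, hχ, mul_cassiniChart h₀]
  obtain ⟨k, hk⟩ : ∃ k : ℂ → (Fin (Module.finrank ℝ A) → ℂ),
      k = fun w => (χ w - z₀.re)⁻¹ • g w := ⟨_, rfl⟩
  have hχi : ContinuousAt (fun w => (χ w - z₀.re)⁻¹) 0 :=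
    (hχc.sub continuousAt_const).inv₀ hζ0
  have hζ : ∀ᶠ w in 𝓝 0, χ w - z₀.re ≠ 0 :=
    (hχc.sub continuousAt_const).eventually_ne hζ0
  have hkd : ∀ᶠ w in 𝓝[≠] 0, DifferentiableAt ℂ k w := by
    filter_upwards [hgd, nhdsWithin_le_nhds hsmall, nhdsWithin_le_nhds hζ] with w h1 h2 h3
    rw [hk]
    exact (((hχd w h2).sub_const _).fun_inv h3).fun_smul h1
  have hkb : k =O[𝓝[≠] 0] (fun _ => (1 : ℝ)) := by
    rw [hk]
    simpa using ((hχi.isBigO_one ℝ).mono nhdsWithin_le_nhds).smul hgb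
  obtain ⟨ge, r₁, hr₁, hgs⟩ := exists_hasSum_of_isBigO_one hgd hgb
  obtain ⟨ke, r₂, hr₂, hks⟩ := exists_hasSum_of_isBigO_one hkd hkb
  obtain ⟨r₃, hr₃, hζr⟩ := Metric.eventually_nhds_iff.1 hζ
  refine ⟨fun n => ((coords A).symm (ge n)).1, fun n => ((coords A).symm (ke n)).1,
    min (min r₁ r₂) (min r₃ (z₀.im ^ 2)), by positivity, fun z w hz hw hw0 hzr => ?_⟩
  simp only [lt_min_iff] at hzr
  obtain ⟨⟨hzr₁, hzr₂⟩, hzr₃, hzr₄⟩ := hzr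
  have hχw : χ w = z := by rw [hw, hχ]; exact cassiniChart_mul h₀ hz
  have hζw : z - z₀.re ≠ 0 := by
    have := hζr (y := w) (by simpa using hzr₃)
    rwa [hχw] at this
  refine ⟨_, _, hasSum_coords_fst_symm hw0 hzr₁ hgs, hasSum_coords_fst_symm hw0 hzr₂ hks, ?_⟩
  have h3 : star (k (conj w)) = -((z - z₀.re)⁻¹ • star (g (conj w))) := by
    simp only [hk, star_smul]
    have := conj_cassiniChart (z₀ := z₀) hzr₄
    rw [← hχ, hχw] at this
    rw [star_inv₀, star_def, this, inv_neg, neg_smul]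
  have hgw : w ^ m • coords A (F z) = g w := by simp only [hg, hχw]
  have hkw : k w = (z - z₀.re)⁻¹ • g w := by simp only [hk, hχw]
  rw [h3, hkw, hgw]
  generalize g w = u
  generalize star (g (conj w)) = u'
  rw [smul_comm, smul_add (z - (z₀.re : ℂ)), smul_neg, smul_inv_smul₀ hζw, smul_inv_smul₀ hζw]
  module

/-- A stem function with a pole of order at most `m` at `z₀` has a spherical expansion beginning at
the index `-2m`. -/
theorem exists_hasSum_sphericalStem (h₀ : 0 < z₀.im) (hJ : J ∈ imagUnits A) (hF : HolNear z₀ F)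
    {m : ℕ} (h : mulPow z₀ F m =O[𝓝[≠] z₀] (fun _ => (1 : ℝ))) :
    ∃ c : ℤ → A, (∀ n : ℤ, n < -((2 * m : ℕ) : ℤ) → c n = 0) ∧ ∃ r : ℝ, 0 < r ∧
      ∀ z : ℂ, 0 < z.im → 0 < ‖deltaStem (slicePt J z₀) z‖ → ‖deltaStem (slicePt J z₀) z‖ < r →
        HasSum (fun n : ℤ => cMul (sphericalStem (slicePt J z₀) n z) (ofA (c n))) (F z) := by
  obtain ⟨p, q, r, hr, hpq⟩ := exists_hasSum_pow_mul_coords h₀ hF h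
  obtain ⟨b, hb⟩ : ∃ b : A, b = z₀.im • J := ⟨_, rfl⟩
  obtain ⟨c', hc'⟩ : ∃ c' : ℕ → A, c' = fun n =>
    if Even n then p (n / 2) + b * q (n / 2) else q (n / 2) := ⟨_, rfl⟩
  have hc0 : ∀ n, c' (2 * n) = p n + b * q n := fun n => by simp [hc']
  have hc1 : ∀ n, c' (2 * n + 1) = q n := fun n => by
    rw [hc']
    simp only
    rw [if_neg (by simp), show (2 * n + 1) / 2 = n by omega]
  have hi : Function.Injective fun n : ℕ => (n : ℤ) - 2 * m := fun a b hab => by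
    simp only at hab; omega
  refine ⟨fun n => if -(2 * m : ℤ) ≤ n then c' (n + 2 * m).toNat else 0, fun n hn =>
    if_neg (by push_cast at hn; omega), r, hr, fun z hz hz0 hzr => ?_⟩
  have hw := deltaStem_slicePt hJ z₀ z
  obtain ⟨w, hwdef⟩ : ∃ w, w = deltaStem (slicePt J z₀) z := ⟨_, rfl⟩
  rw [← hwdef] at hz0 hzr hw
  have hw0 : w ≠ 0 := norm_pos_iff.1 hz0
  obtain ⟨s₁, s₂, hs1, hs2, hs12⟩ := hpq z w hz hw hw0 hzr
  obtain ⟨M, hM⟩ : ∃ M : (Fin (Module.finrank ℝ A) → ℂ) →L[ℝ] (Fin (Module.finrank ℝ A) → ℂ),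
      M = ((coords A).toContinuousLinearMap.comp ((mulL b).prodMap (mulL b))).comp
      (coords A).symm.toContinuousLinearMap := ⟨_, rfl⟩
  have hMc : ∀ (n : ℕ) (a : A), M (w ^ n • coords A (a, 0)) = w ^ n • coords A (b * a, 0) := by
    intro n a
    rw [← coords_cMul_ofC, ← coords_cMul_ofC]
    simp [hM, cMul_ofC]
  have hyz : ofC z - ofA (slicePt J z₀) = ofC (z - z₀.re) - ofA b := by
    ext <;> simp [ofC, ofA, slicePt, hb, sub_smul, sub_sub]
  have heven : HasSum (fun n : ℕ =>
      coords A (cMul (sphericalStem (slicePt J z₀) ((2 * n : ℕ) : ℤ) z) (ofA (c' (2 * n)))))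
      (s₁ + M s₂) := by
    refine (hs1.add (M.hasSum hs2)).congr_fun fun n => ?_
    rw [Nat.cast_mul, Nat.cast_ofNat, sphericalStem_even, coords_cMul_ofC, ← hwdef, zpow_natCast,
      hMc, ← smul_add, ← map_add]
    rw [hc0]
    simp [ofA]
  have hodd : HasSum (fun n : ℕ =>
      coords A (cMul (sphericalStem (slicePt J z₀) ((2 * n + 1 : ℕ) : ℤ) z) (ofA (c' (2 * n + 1)))))
      ((z - z₀.re) • s₂ - M s₂) := by
    refine ((hs2.const_smul (z - z₀.re)).sub (M.hasSum hs2)).congr_fun fun n => ?_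
    rw [Nat.cast_add, Nat.cast_mul, Nat.cast_ofNat, Nat.cast_one, sphericalStem_odd,
      coords_cMul_ofC, ← hwdef, zpow_natCast, hMc, smul_comm, ← smul_sub,
      ← coords_cMul_ofC (z - z₀.re), ← map_sub, hyz]
    rw [hc1]
    congr 2
    simp [cMul, ofA, sub_mul]
  have hsum := HasSum.even_add_odd (f := fun n : ℕ =>
    coords A (cMul (sphericalStem (slicePt J z₀) (n : ℤ) z) (ofA (c' n)))) heven hodd
  rw [add_add_sub_cancel, hs12] at hsum
  rw [← hi.hasSum_iff]
  · have h4 := (coords A).symm.toContinuousLinearMap.hasSum (hsum.const_smul (w ^ m)⁻¹)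
    have hwm : w ^ m ≠ 0 := pow_ne_zero _ hw0
    convert h4 using 1
    · ext1 n
      have h5 := sphericalStem_sub (slicePt J z₀) (z := z) (hwdef ▸ hw0) m n (c' n)
      have h6 : (if -(2 * (m : ℤ)) ≤ (n : ℤ) - 2 * m
          then c' ((n : ℤ) - 2 * m + 2 * m).toNat else 0) = c' n := by
        rw [if_pos (by omega)]; simp
      simp only [Function.comp_apply]
      rw [h6, ← h5, ← hwdef, coords_cMul_ofC, inv_smul_smul₀ hwm]
      simp
    · rw [inv_smul_smul₀ hwm]
      simp
  · intro x hx
    have hxm : ¬ -(2 * m : ℤ) ≤ x := fun hxm => hx ⟨(x + 2 * m).toNat, by simp only; omega⟩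
    simp only [if_neg hxm]
    simp [cMul, ofA]

/-- A spherical expansion beginning at the index `-2m` forces a pole of order at most `m`: its
convergence at one point bounds the coefficients geometrically. -/
theorem isBigO_one_of_hasSum_sphericalStem (h₀ : z₀.im ≠ 0) (hJ : J ∈ imagUnits A)
    {m : ℕ} {c : ℤ → A} (hc : ∀ n : ℤ, n < -((2 * m : ℕ) : ℤ) → c n = 0) {r : ℝ} (hr : 0 < r)
    (h : ∀ z : ℂ, z ≠ z₀ → ‖z - z₀‖ < r →
      HasSum (fun n : ℤ => cMul (sphericalStem (slicePt J z₀) n z) (ofA (c n))) (F z)) :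
    mulPow z₀ F m =O[𝓝[≠] z₀] (fun _ => (1 : ℝ)) := by
  have hconj : z₀ ≠ conj z₀ := fun h => h₀ (Complex.conj_eq_iff_im.1 h.symm)
  set d : ℂ → ℂ := fun z => deltaStem (slicePt J z₀) z with hd
  have hdm : ∀ z, d z = (z - z₀) * (z - conj z₀) := fun z => deltaStem_slicePt hJ z₀ z
  have hdc : Continuous d := by
    have : d = fun z => (z - z₀) * (z - conj z₀) := funext hdm
    rw [this]; fun_prop
  have hi : Function.Injective fun n : ℕ => (n : ℤ) - 2 * m := fun a b hab => by
    simp only at hab; omega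
  -- the terms of the expansion of `Δ^m F`, indexed by the natural numbers
  set b : ℕ → A := fun n => c ((n : ℤ) - 2 * m) with hb
  set Y : ℕ → ℂ → A × A := fun n z =>
    if Even n then ofA (b n) else cMul (ofC z - ofA (slicePt J z₀)) (ofA (b n)) with hY
  have hs : ∀ z : ℂ, z ≠ z₀ → ‖z - z₀‖ < r → d z ≠ 0 →
      HasSum (fun n : ℕ => d z ^ (n / 2) • coords A (Y n z))
        (coords A (cMul (ofC (d z ^ m)) (F z))) := by
    intro z hz hzr hdz
    have h1 := h z hz hzr
    rw [← hi.hasSum_iff] at h1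
    · have h2 := ((coords A).toContinuousLinearMap.hasSum h1).const_smul (d z ^ m)
      simp only [ContinuousLinearEquiv.coe_coe, ← coords_cMul_ofC, Function.comp_apply] at h2
      refine h2.congr_fun fun n => ?_
      rw [sphericalStem_sub _ hdz, ← coords_cMul_ofC]
      rcases Nat.even_or_odd' n with ⟨k, rfl | rfl⟩
      · rw [Nat.cast_mul, Nat.cast_ofNat, sphericalStem_even, zpow_natCast]
        simp [hY, hb, hd, cMul, ofC, ofA]
      · rw [Nat.cast_add, Nat.cast_mul, Nat.cast_ofNat, Nat.cast_one, sphericalStem_odd,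
          zpow_natCast, show (2 * k + 1) / 2 = k by omega]
        simp [hY, hb, hd]
    · intro x hx
      have hxm : x < -((2 * m : ℕ) : ℤ) := by
        push_cast
        by_contra hxm
        exact hx ⟨(x + 2 * m).toNat, by simp only; omega⟩
      rw [hc x hxm]
      simp [cMul, ofA]
  -- convergence at one point bounds the coefficients
  obtain ⟨z₁, hz₁, hz₁r, hdz₁, hz₁im⟩ : ∃ z₁ : ℂ, z₁ ≠ z₀ ∧ ‖z₁ - z₀‖ < r ∧ d z₁ ≠ 0 ∧
      z₁.im ≠ 0 := by
    refine ⟨z₀ + (r / 2 : ℝ), by simp [hr.ne'], ?_, ?_, by simpa using h₀⟩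
    · simp only [add_sub_cancel_left, norm_real, Real.norm_eq_abs]
      rw [abs_of_pos (by positivity)]; linarith
    · rw [hdm]
      refine mul_ne_zero (by simp [hr.ne']) fun h => h₀ ?_
      have := congrArg Complex.im h
      simp at this
      linarith
  obtain ⟨C, hC⟩ := (hs z₁ hz₁ hz₁r hdz₁).summable.tendsto_atTop_zero.norm.bddAbove_range
  have hC' : ∀ n, ‖d z₁‖ ^ (n / 2) * ‖coords A (Y n z₁)‖ ≤ C := fun n => by
    have := hC ⟨n, rfl⟩
    simpa [norm_smul] using this
  obtain ⟨K, hK⟩ : ∃ K : ℝ, ∀ n, ‖b n‖ ≤ K * ‖coords A (Y n z₁)‖ := by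
    set S := (coords A).symm.toContinuousLinearMap with hS
    have h1 : ∀ p : A × A, ‖p‖ ≤ ‖S‖ * ‖coords A p‖ := fun p => by
      have := S.le_opNorm (coords A p)
      simpa [hS] using this
    refine ⟨(1 + ‖z₁.im⁻¹‖) * ‖S‖, fun n => ?_⟩
    rw [mul_assoc]
    refine le_trans ?_ (mul_le_mul_of_nonneg_left (h1 (Y n z₁)) (by positivity))
    by_cases hn : Even n
    · simp only [hY, if_pos hn, ofA, Prod.norm_mk, norm_zero]
      rw [max_eq_left (norm_nonneg _)]
      nlinarith [norm_nonneg (b n), norm_nonneg (z₁.im⁻¹)]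
    · have h2 : b n = z₁.im⁻¹ • (Y n z₁).2 := by
        simp [hY, if_neg hn, cMul, ofC, ofA, smul_smul, hz₁im]
      have h3 : ‖(Y n z₁).2‖ ≤ ‖Y n z₁‖ := norm_snd_le _
      calc ‖b n‖ = ‖z₁.im⁻¹‖ * ‖(Y n z₁).2‖ := by rw [h2, norm_smul]
        _ ≤ ‖z₁.im⁻¹‖ * ‖Y n z₁‖ := by gcongr
        _ ≤ (1 + ‖z₁.im⁻¹‖) * ‖Y n z₁‖ := by nlinarith [norm_nonneg (Y n z₁)]
  obtain ⟨K', hK'0, hK'⟩ : ∃ K' : ℝ, 0 ≤ K' ∧ ∀ n z, ‖z - z₀‖ < 1 →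
      ‖coords A (Y n z)‖ ≤ K' * ‖b n‖ := by
    set S := (coords A).toContinuousLinearMap with hS
    set N := 1 + (‖z₀‖ + 1 + ‖mulL (slicePt J z₀)‖ + (‖z₀‖ + 1)) with hN
    refine ⟨‖S‖ * N, by positivity, fun n z hz => ?_⟩
    refine (S.le_opNorm (Y n z)).trans ?_
    rw [mul_assoc]
    refine mul_le_mul_of_nonneg_left ?_ (norm_nonneg _)
    have hzn : ‖z‖ ≤ ‖z₀‖ + 1 := by
      have := norm_add_le z₀ (z - z₀)
      rw [add_sub_cancel] at this
      linarith
    by_cases hn : Even n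
    · simp only [hY, if_pos hn, ofA, Prod.norm_mk, norm_zero]
      rw [max_eq_left (norm_nonneg _), hN, add_mul, one_mul]
      have : 0 ≤ (‖z₀‖ + 1 + ‖mulL (slicePt J z₀)‖ + (‖z₀‖ + 1)) * ‖b n‖ := by positivity
      linarith
    · have h1 : Y n z = (z.re • b n - slicePt J z₀ * b n, z.im • b n) := by
        simp [hY, if_neg hn, cMul, ofC, ofA, sub_mul]
      have h2 : ‖z.re • b n‖ ≤ (‖z₀‖ + 1) * ‖b n‖ := by
        rw [norm_smul, Real.norm_eq_abs]
        gcongr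
        exact (Complex.abs_re_le_norm z).trans hzn
      have h3 : ‖z.im • b n‖ ≤ (‖z₀‖ + 1) * ‖b n‖ := by
        rw [norm_smul, Real.norm_eq_abs]
        gcongr
        exact (Complex.abs_im_le_norm z).trans hzn
      have h4 : ‖slicePt J z₀ * b n‖ ≤ ‖mulL (slicePt J z₀)‖ * ‖b n‖ :=
        (mulL (slicePt J z₀)).le_opNorm (b n)
      have h5 := norm_sub_le (z.re • b n) (slicePt J z₀ * b n)
      have h6 : 0 ≤ (‖z₀‖ + 1) * ‖b n‖ := by positivity
      have h7 : 0 ≤ ‖mulL (slicePt J z₀)‖ * ‖b n‖ := by positivity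
      have h8 := norm_nonneg (b n)
      have h9 : N * ‖b n‖ = ‖b n‖ + ((‖z₀‖ + 1) * ‖b n‖ + ‖mulL (slicePt J z₀)‖ * ‖b n‖ +
        (‖z₀‖ + 1) * ‖b n‖) := by rw [hN]; ring
      rw [h1, Prod.norm_mk, h9]
      exact max_le (by linarith) (by linarith)
  have hK0 : 0 ≤ |K| := abs_nonneg K
  have hbound : (fun z => coords A (cMul (ofC (d z ^ m)) (F z))) =O[𝓝[≠] z₀]
      (fun _ => (1 : ℝ)) := by
    refine IsBigO.of_bound (K' * |K| * C * 2 * 2) ?_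
    rw [eventually_nhdsWithin_iff]
    have e1 : ∀ᶠ z in 𝓝 z₀, ‖d z‖ < ‖d z₁‖ * (1 / 2) ^ 2 := by
      have : ‖d z₀‖ < ‖d z₁‖ * (1 / 2) ^ 2 := by
        rw [hdm z₀, sub_self, zero_mul, norm_zero]
        have := norm_pos_iff.2 hdz₁
        positivity
      exact hdc.norm.continuousAt.eventually_lt continuousAt_const this
    have e2 : ∀ᶠ z in 𝓝 z₀, z ≠ conj z₀ := eventually_ne_nhds hconj
    filter_upwards [e1, e2, Metric.ball_mem_nhds z₀ one_pos, Metric.ball_mem_nhds z₀ hr]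
      with z he1 he2 he3 he4 hz
    rw [Metric.mem_ball, dist_eq_norm] at he3 he4
    have hdz : d z ≠ 0 := by
      rw [hdm]; exact mul_ne_zero (sub_ne_zero.2 hz) (sub_ne_zero.2 he2)
    simp only [norm_one, mul_one]
    refine (hs z hz he4 hdz).norm_le_of_bounded
      (g := fun n : ℕ => K' * |K| * C * 2 * (1 / 2) ^ n)
      (hasSum_geometric_two.mul_left (K' * |K| * C * 2)) fun n => ?_
    have hC0 : 0 ≤ C := (by positivity : (0 : ℝ) ≤ _).trans (hC' n)
    have hgeo : ((1 / 2 : ℝ) ^ 2) ^ (n / 2) ≤ 2 * (1 / 2) ^ n := by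
      rw [← pow_mul]
      rcases Nat.even_or_odd' n with ⟨k, rfl | rfl⟩
      · rw [show 2 * (2 * k / 2) = 2 * k by omega]
        have : (0 : ℝ) ≤ (1 / 2) ^ (2 * k) := by positivity
        linarith
      · rw [show 2 * ((2 * k + 1) / 2) = 2 * k by omega, pow_succ]
        linarith
    calc ‖d z ^ (n / 2) • coords A (Y n z)‖
        = ‖d z‖ ^ (n / 2) * ‖coords A (Y n z)‖ := by rw [norm_smul, norm_pow]
      _ ≤ (‖d z₁‖ * (1 / 2) ^ 2) ^ (n / 2) * (K' * (|K| * ‖coords A (Y n z₁)‖)) := by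
          gcongr
          refine (hK' n z he3).trans ?_
          gcongr
          exact (hK n).trans (by gcongr; exact le_abs_self K)
      _ = K' * |K| * (‖d z₁‖ ^ (n / 2) * ‖coords A (Y n z₁)‖) * ((1 / 2) ^ 2) ^ (n / 2) := by
          rw [mul_pow]; ring
      _ ≤ K' * |K| * C * (2 * (1 / 2) ^ n) := by
          gcongr
          exact hC' n
      _ = K' * |K| * C * 2 * (1 / 2) ^ n := by ring
  have h3 := ((coords A).symm.toContinuousLinearMap.isBigO_comp _ _).trans hbound
  have hφ : ContinuousAt (fun z => ((z - conj z₀) ^ m)⁻¹) z₀ :=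
    ContinuousAt.inv₀ (by fun_prop) (pow_ne_zero _ (sub_ne_zero.2 hconj))
  refine (isBigO_one_cMul_ofC hφ h3).congr' ?_ EventuallyEq.rfl
  filter_upwards [nhdsWithin_le_nhds (eventually_ne_nhds hconj)] with z hz
  simp only [ContinuousLinearEquiv.coe_coe, ContinuousLinearEquiv.symm_apply_apply, mulPow,
    ← cMul_ofC_ofC_mul]
  congr 2
  rw [hdm, mul_pow, mul_comm, mul_assoc, mul_inv_cancel₀ (pow_ne_zero _ (sub_ne_zero.2 hz)),
    mul_one]

end Spherical

/-! ### The orders in terms of the stem function -/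

section Orders

variable {A : Type*} [NormedNonAssocRing A] [NormedSpace ℝ A] [FiniteDimensional ℝ A]
  [StarRing A] [StarModule ℝ A] [IsScalarTower ℝ A A] [SMulCommClass ℝ A A] [Nontrivial A]
  [IsAlternativeRing A] {z₀ : ℂ} {F : ℂ → A × A} {I J : A} {Ω : Set A} {f : A → A}

/-- Near the sphere through `z₀`, the function `f` on `Ω` is induced by `F`. -/
def InducedNear (Ω : Set A) (f : A → A) (z₀ : ℂ) (F : ℂ → A × A) : Prop :=
  ∀ᶠ z in 𝓝[≠] z₀, ∀ I ∈ imagUnits A, slicePt I z ∈ Ω ∧ f (slicePt I z) = cEval I (F z)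

theorem rePart_slicePt (hJ : J ∈ imagUnits A) (z : ℂ) : rePart (slicePt J z) = z.re • (1 : A) := by
  have h := trace_slicePt hJ z
  rw [trace] at h
  rw [rePart, h, smul_smul]
  congr 1
  ring

theorem imPart_slicePt (hJ : J ∈ imagUnits A) (z : ℂ) : imPart (slicePt J z) = z.im • J := by
  rw [imPart, rePart_slicePt hJ, slicePt, add_sub_cancel_left]

theorem continuous_slicePt (J : A) : Continuous (slicePt J) := by
  unfold slicePt
  exact (Complex.continuous_re.smul continuous_const).add
    (Complex.continuous_im.smul continuous_const)

variable (hnorm : ∀ x ∈ quadraticCone A, (‖x‖ ^ 2 : ℝ) • (1 : A) = normSq x)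
include hnorm

theorem norm_imPart_slicePt (hJ : J ∈ imagUnits A) (z : ℂ) : ‖imPart (slicePt J z)‖ = |z.im| := by
  have h := norm_slicePt hnorm hJ (⟨0, z.im⟩ : ℂ)
  rw [imPart_slicePt hJ]
  have h2 : ‖(⟨0, z.im⟩ : ℂ)‖ = |z.im| := by
    rw [show (⟨0, z.im⟩ : ℂ) = z.im * Complex.I by apply Complex.ext <;> simp]
    simp
  rw [← h2, ← h]
  simp [slicePt]

theorem norm_slicePt_sub (hJ : J ∈ imagUnits A) (z w : ℂ) :
    ‖slicePt J z - slicePt J w‖ = ‖z - w‖ := by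
  rw [← slicePt_sub, norm_slicePt hnorm hJ]

theorem mem_sigmaShell_slicePt (hJ : J ∈ imagUnits A) {z : ℂ} (hz : z ≠ z₀) {R : ℝ}
    (hzR : ‖z - z₀‖ < R) : slicePt J z ∈ sigmaShell (slicePt J z₀) 0 R := by
  have hs : SameSlice (slicePt J z) (slicePt J z₀) := ⟨J, hJ, ⟨z, rfl⟩, ⟨z₀, rfl⟩⟩
  refine ⟨slicePt_mem_quadraticCone hJ z, ?_, ?_⟩
  · rw [tauDist, if_pos hs, norm_slicePt_sub hnorm hJ]
    exact norm_pos_iff.2 (sub_ne_zero.2 hz)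
  · rwa [sigmaDist, if_pos hs, norm_slicePt_sub hnorm hJ]

/-- For small `R`, the set `Σ(y, 0, R)` is a punctured disc in the plane `ℂ_J` through `y`. -/
theorem exists_of_mem_sigmaShell (h₀ : z₀.im ≠ 0) (hJ : J ∈ imagUnits A) {R : ℝ}
    (hR : R ≤ |z₀.im|) {x : A} (hx : x ∈ sigmaShell (slicePt J z₀) 0 R) :
    ∃ z, z ≠ z₀ ∧ ‖z - z₀‖ < R ∧ x = slicePt J z := by
  obtain ⟨hxQ, hx0, hxR⟩ := hx
  have hs : SameSlice x (slicePt J z₀) := by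
    by_contra hs
    rw [sigmaDist, if_neg hs] at hxR
    have h1 : |z₀.im| ≤ Real.sqrt (‖rePart x - rePart (slicePt J z₀)‖ ^ 2 +
        (‖imPart x‖ + ‖imPart (slicePt J z₀)‖) ^ 2) := by
      apply Real.le_sqrt_of_sq_le
      rw [norm_imPart_slicePt hnorm hJ]
      nlinarith [norm_nonneg (imPart x), abs_nonneg z₀.im,
        sq_nonneg ‖rePart x - rePart (slicePt J z₀)‖,
        mul_nonneg (norm_nonneg (imPart x)) (abs_nonneg z₀.im), sq_nonneg ‖imPart x‖]
    linarith
  rw [tauDist, if_pos hs] at hx0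
  rw [sigmaDist, if_pos hs] at hxR
  obtain ⟨K, hK, ⟨z, rfl⟩, ⟨w, hw⟩⟩ := hs
  have hz : ∃ z', slicePt K z = slicePt J z' := by
    rcases (slicePt_eq_slicePt hnorm hJ hK hw).2 h₀ with ⟨rfl, -⟩ | ⟨rfl, -⟩
    · exact ⟨z, rfl⟩
    · exact ⟨conj z, slicePt_neg J z⟩
  obtain ⟨z', hz'⟩ := hz
  rw [hz', norm_slicePt_sub hnorm hJ] at hx0 hxR
  exact ⟨z', sub_ne_zero.1 (norm_pos_iff.1 hx0), hxR, hz'⟩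

/-- A slice regular function with a singularity at `y` is induced near `y` by a stem function that
is holomorphic in a punctured neighbourhood. -/
theorem exists_stem_near (hf : IsSliceRegularOn Ω f) (hJ : J ∈ imagUnits A)
    (hy : IsSingularity Ω (slicePt J z₀)) :
    ∃ F : ℂ → A × A, HolNear z₀ F ∧ InducedNear Ω f z₀ F := by
  obtain ⟨D, -, hDc, hΩ, ⟨O, hO, hΩO⟩, F, -, hind, hC1, hCR⟩ := hf
  have hmem : ∀ z, slicePt J z ∈ Ω → z ∈ D := by
    intro z hz
    rw [hΩ] at hz
    obtain ⟨-, w, hw, K, hK, hzw⟩ := hz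
    rcases (slicePt_eq_slicePt hnorm hK hJ hzw).1 with rfl | rfl
    · exact hw
    · exact hDc _ hw
  have hDopen : IsOpen D := by
    have : D = slicePt J ⁻¹' O := by
      ext z
      constructor
      · intro hz
        have : slicePt J z ∈ Ω := by
          rw [hΩ]; exact ⟨slicePt_mem_quadraticCone hJ z, z, hz, J, hJ, rfl⟩
        rw [hΩO] at this
        exact this.2
      · intro hz
        refine hmem z ?_
        rw [hΩO]
        exact ⟨slicePt_mem_quadraticCone hJ z, hz⟩
    rw [this]
    exact hO.preimage (continuous_slicePt J)
  obtain ⟨-, R, hR, hshell⟩ := hy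
  have hD : ∀ᶠ z in 𝓝[≠] z₀, z ∈ D := by
    rw [eventually_nhdsWithin_iff]
    filter_upwards [Metric.ball_mem_nhds z₀ hR] with z hz hz0
    rw [Metric.mem_ball, dist_eq_norm] at hz
    exact hmem z (hshell (mem_sigmaShell_slicePt hnorm hJ hz0 hz))
  refine ⟨F, ?_, ?_⟩
  · filter_upwards [hD] with z hz
    exact ⟨(hC1.contDiffAt (hDopen.mem_nhds hz)).differentiableAt one_ne_zero, hCR z hz⟩
  · filter_upwards [hD] with z hz K hK
    refine ⟨?_, hind z hz K hK⟩
    rw [hΩ]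
    exact ⟨slicePt_mem_quadraticCone hK z, z, hz, K, hK, rfl⟩

theorem HasLaurentExpansion.of_hasSum (h₀ : z₀.im ≠ 0) (hJ : J ∈ imagUnits A)
    (hind : InducedNear Ω f z₀ F) {a : ℤ → A} {r : ℝ} (hr : 0 < r)
    (h : ∀ z, z ≠ z₀ → ‖z - z₀‖ < r →
      HasSum (fun n : ℤ => slicePt J ((z - z₀) ^ n) * a n) (cEval J (F z))) :
    HasLaurentExpansion Ω f (slicePt J z₀) a := by
  obtain ⟨r', hr', hball⟩ := Metric.mem_nhdsWithin_iff.1 hind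
  have hb : 0 < |z₀.im| := abs_pos.2 h₀
  have key : ∀ {x : A}, x ∈ sigmaShell (slicePt J z₀) 0 (min (min r r') |z₀.im|) →
      ∃ w, w ≠ z₀ ∧ ‖w - z₀‖ < r ∧ w.im ≠ 0 ∧ x = slicePt J w ∧ slicePt J w ∈ Ω ∧
        f (slicePt J w) = cEval J (F w) := by
    intro x hx
    obtain ⟨w, hw, hwR, rfl⟩ := exists_of_mem_sigmaShell hnorm h₀ hJ (min_le_right _ _) hx
    simp only [lt_min_iff] at hwR
    have hwi := hball ⟨by rw [Metric.mem_ball, dist_eq_norm]; exact hwR.1.2, hw⟩ J hJ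
    refine ⟨w, hw, hwR.1.1, fun h => ?_, rfl, hwi⟩
    have := (Complex.abs_im_le_norm (w - z₀)).trans_lt hwR.2
    rw [Complex.sub_im, h, zero_sub, abs_neg] at this
    exact lt_irrefl _ this
  refine ⟨min (min r r') |z₀.im|, by positivity, fun x hx => ?_, fun z K hK hz => ?_⟩
  · obtain ⟨w, -, -, -, rfl, hw, -⟩ := key hx
    exact hw
  · obtain ⟨w, hw, hwr, hwim, hzw, -, hfw⟩ := key hz
    have hwc : w ≠ conj z₀ := by
      intro hwc
      have h1 : (‖w - z₀‖ : ℝ) < |z₀.im| := by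
        obtain ⟨w', -, hw'R, hw'⟩ := exists_of_mem_sigmaShell hnorm h₀ hJ (min_le_right _ _) hz
        have h2 : ‖w - w'‖ = 0 := by
          rw [← norm_slicePt_sub hnorm hJ, ← hzw, ← hw', sub_self, norm_zero]
        rw [sub_eq_zero.1 (norm_eq_zero.1 h2)]
        exact hw'R.trans_le (min_le_right _ _)
      have h2 := (Complex.abs_im_le_norm (w - z₀)).trans_lt h1
      rw [hwc, Complex.sub_im, Complex.conj_im, ← neg_add', abs_neg, ← two_mul, abs_mul] at h2
      norm_num at h2
      linarith
    rw [hzw, hfw]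
    refine (h w hw hwr).congr_fun fun n => ?_
    rcases (slicePt_eq_slicePt hnorm hJ hK hzw).2 hwim with ⟨rfl, rfl⟩ | ⟨rfl, rfl⟩
    · exact cEval_binomStem hK hwc n (a n)
    · -- the point and its powers are rewritten in terms of `-J` and `conj z₀`
      have h1 := cEval_binomStem hK (w := conj z₀) (z := conj w)
        (fun h => hwc (by rw [Complex.conj_conj] at h; rw [← h, Complex.conj_conj])) n (a n)
      rw [slicePt_conj_neg, ← map_sub, ← map_zpow₀, slicePt_conj_neg] at h1
      exact h1

theorem HasLaurentExpansion.exists_hasSum (h₀ : z₀.im ≠ 0) (hJ : J ∈ imagUnits A)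
    (hind : InducedNear Ω f z₀ F) {a : ℤ → A} (h : HasLaurentExpansion Ω f (slicePt J z₀) a) :
    ∃ r : ℝ, 0 < r ∧ ∀ z, z ≠ z₀ → ‖z - z₀‖ < r →
      HasSum (fun n : ℤ => slicePt J ((z - z₀) ^ n) * a n) (cEval J (F z)) := by
  obtain ⟨R, hR, -, hs⟩ := h
  have hconj : z₀ ≠ conj z₀ := fun h => h₀ (Complex.conj_eq_iff_im.1 h.symm)
  obtain ⟨r, hr, hball⟩ := Metric.mem_nhdsWithin_iff.1
    (hind.and (nhdsWithin_le_nhds (eventually_ne_nhds hconj)))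
  refine ⟨min r R, by positivity, fun z hz hzr => ?_⟩
  rw [lt_min_iff] at hzr
  obtain ⟨h1, h2⟩ := hball ⟨by rw [Metric.mem_ball, dist_eq_norm]; exact hzr.1, hz⟩
  rw [← (h1 J hJ).2]
  exact (hs z J hJ (mem_sigmaShell_slicePt hnorm hJ hz hzr.2)).congr_fun fun n =>
    (cEval_binomStem hJ h2 n (a n)).symm

/-- The order of `f` at `slicePt J z₀` is the order of the pole at `z₀` of the stem function
evaluated at `J`. -/
theorem exists_hasLaurentExpansion_iff (h₀ : z₀.im ≠ 0) (hJ : J ∈ imagUnits A)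
    (hF : HolNear z₀ F) (hind : InducedNear Ω f z₀ F) (m : ℕ) :
    (∃ a : ℤ → A, HasLaurentExpansion Ω f (slicePt J z₀) a ∧
      ∀ k : ℕ, m < k → a (-(k : ℤ)) = 0) ↔
    (fun z => cEval J (mulPow z₀ F m z)) =O[𝓝[≠] z₀] (fun _ => (1 : ℝ)) := by
  constructor
  · rintro ⟨a, ha, ha0⟩
    obtain ⟨r, hr, hs⟩ := ha.exists_hasSum hnorm h₀ hJ hind
    exact isBigO_one_cEval_of_hasSum hJ ha0 hr hs
  · intro h
    obtain ⟨a, ha0, r, hr, hs⟩ := exists_hasSum_slicePt_zpow hJ hF h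
    exact ⟨a, HasLaurentExpansion.of_hasSum hnorm h₀ hJ hind hr hs, ha0⟩

theorem norm_delta_slicePt (hI : I ∈ imagUnits A) (y : A) (z : ℂ) :
    ‖delta y (slicePt I z)‖ = ‖deltaStem y z‖ := by
  rw [delta_slicePt hI, norm_slicePt hnorm hI]

/-- An expansion of the stem function in the upper half plane gives the expansion of `f` on a Cassini
shell: a point of the shell is also represented by `-K` and `conj z`. -/
theorem HasSphericalExpansion.of_hasSum (h₀ : 0 < z₀.im) (hJ : J ∈ imagUnits A)
    (hind : InducedNear Ω f z₀ F) {c : ℤ → A} {r : ℝ} (hr : 0 < r)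
    (h : ∀ z : ℂ, 0 < z.im → 0 < ‖deltaStem (slicePt J z₀) z‖ →
      ‖deltaStem (slicePt J z₀) z‖ < r →
        HasSum (fun n : ℤ => cMul (sphericalStem (slicePt J z₀) n z) (ofA (c n))) (F z)) :
    HasSphericalExpansion Ω f (slicePt J z₀) c := by
  obtain ⟨r', hr', hcas⟩ := exists_of_eventually_cassini h₀ hind
  have hmin : 0 < min (min r r') (z₀.im ^ 2) := by positivity
  -- points of the shell are not real, and one of their two representations is near `z₀`
  have key : ∀ {z : ℂ} {K : A}, K ∈ imagUnits A →
      slicePt K z ∈ cassiniShell (slicePt J z₀) 0 (Real.sqrt (min (min r r') (z₀.im ^ 2))) →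
      ∃ w : ℂ, ∃ L ∈ imagUnits A, (w = z ∧ L = K ∨ w = conj z ∧ L = -K) ∧ 0 < w.im ∧
        0 < ‖deltaStem (slicePt J z₀) w‖ ∧ ‖deltaStem (slicePt J z₀) w‖ < r ∧
        slicePt L w ∈ Ω ∧ f (slicePt L w) = cEval L (F w) := by
    rintro z K hK ⟨-, hz0, hzr⟩
    rw [norm_delta_slicePt hnorm hK] at hz0 hzr
    rw [Real.sqrt_pos] at hz0
    rw [Real.sqrt_lt_sqrt_iff (norm_nonneg _)] at hzr
    simp only [lt_min_iff] at hzr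
    obtain ⟨⟨hzr₁, hzr₂⟩, hzr₃⟩ := hzr
    have hzim : z.im ≠ 0 := by
      intro hz
      have h1 := Complex.abs_re_le_norm (deltaStem (slicePt J z₀) z)
      have h2 : (deltaStem (slicePt J z₀) z).re = (z.re - z₀.re) ^ 2 + z₀.im ^ 2 := by
        rw [deltaStem_slicePt hJ]
        simp [Complex.mul_re, hz]
        ring
      have h3 := (le_abs_self _).trans_lt (h1.trans_lt hzr₃)
      rw [h2] at h3
      nlinarith [sq_nonneg (z.re - z₀.re)]
    have main : ∀ w L, L ∈ imagUnits A → 0 < w.im →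
        ‖deltaStem (slicePt J z₀) w‖ = ‖deltaStem (slicePt J z₀) z‖ →
        slicePt L w ∈ Ω ∧ f (slicePt L w) = cEval L (F w) := by
      intro w L hL hw hwz
      have := deltaStem_slicePt hJ z₀ w
      exact hcas w hw (by rwa [← this, hwz]) (by rwa [← this, hwz]) L hL
    rcases lt_or_gt_of_ne hzim with hneg | hpos
    · have hn : ‖deltaStem (slicePt J z₀) (conj z)‖ = ‖deltaStem (slicePt J z₀) z‖ := by
        rw [deltaStem_conj, Complex.norm_conj]
      have hp : 0 < (conj z).im := by simpa using hneg
      refine ⟨conj z, -K, neg_mem_imagUnits hK, Or.inr ⟨rfl, rfl⟩, hp, by rwa [hn], by rwa [hn],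
        main _ _ (neg_mem_imagUnits hK) hp hn⟩
    · exact ⟨z, K, hK, Or.inl ⟨rfl, rfl⟩, hpos, hz0, hzr₁, main _ _ hK hpos rfl⟩
  refine ⟨_, Real.sqrt_pos.2 hmin, fun x hx => ?_, fun z K hK hz => ?_⟩
  · obtain ⟨K, hK, z, rfl⟩ := exists_slicePt_of_mem_quadraticCone hJ hx.1
    obtain ⟨w, L, -, hwL, -, -, -, hΩ, -⟩ := key hK hx
    rcases hwL with ⟨rfl, rfl⟩ | ⟨rfl, rfl⟩
    · exact hΩ
    · rwa [slicePt_conj_neg] at hΩ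
  · obtain ⟨w, L, hL, hwL, hw, hw0, hwr, -, hfw⟩ := key hK hz
    have h1 := (cEvalL L).hasSum (h w hw hw0 hwr)
    simp only [cEvalL_apply] at h1
    rw [← hfw] at h1
    rcases hwL with ⟨rfl, rfl⟩ | ⟨rfl, rfl⟩
    · exact h1
    · rw [slicePt_conj_neg] at h1
      exact h1.congr_fun fun n => (cEval_sphericalStem_conj K _ n z (c n)).symm

/-- The expansions of `f` on `ℂ_J` and `ℂ_{-J}` together give one of the stem function. -/
theorem HasSphericalExpansion.exists_hasSum (h₀ : z₀.im ≠ 0) (hJ : J ∈ imagUnits A)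
    (hind : InducedNear Ω f z₀ F) {c : ℤ → A} (h : HasSphericalExpansion Ω f (slicePt J z₀) c) :
    ∃ r : ℝ, 0 < r ∧ ∀ z, z ≠ z₀ → ‖z - z₀‖ < r →
      HasSum (fun n : ℤ => cMul (sphericalStem (slicePt J z₀) n z) (ofA (c n))) (F z) := by
  obtain ⟨R, hR, -, hs⟩ := h
  have hconj : z₀ ≠ conj z₀ := fun h => h₀ (Complex.conj_eq_iff_im.1 h.symm)
  have hd : ∀ᶠ z in 𝓝 z₀, Real.sqrt ‖deltaStem (slicePt J z₀) z‖ < R := by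
    have hc : Continuous fun z => Real.sqrt ‖deltaStem (slicePt J z₀) z‖ := by
      simp only [deltaStem_slicePt hJ]
      fun_prop
    refine hc.continuousAt.eventually_lt continuousAt_const ?_
    simpa [deltaStem_slicePt hJ] using hR
  obtain ⟨r, hr, hball⟩ := Metric.mem_nhdsWithin_iff.1
    ((hind.and (nhdsWithin_le_nhds hd)).and (nhdsWithin_le_nhds (eventually_ne_nhds hconj)))
  refine ⟨r, hr, fun z hz hzr => ?_⟩
  obtain ⟨⟨h1, h2⟩, h3⟩ := hball ⟨by rw [Metric.mem_ball, dist_eq_norm]; exact hzr, hz⟩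
  have key : ∀ K ∈ imagUnits A, HasSum (fun n : ℤ =>
      cEval K (cMul (sphericalStem (slicePt J z₀) n z) (ofA (c n)))) (cEval K (F z)) := by
    intro K hK
    rw [← (h1 K hK).2]
    refine hs z K hK ⟨slicePt_mem_quadraticCone hK z, ?_, ?_⟩
    · rw [norm_delta_slicePt hnorm hK, Real.sqrt_pos, norm_pos_iff, deltaStem_slicePt hJ]
      exact mul_ne_zero (sub_ne_zero.2 hz) (sub_ne_zero.2 h3)
    · rwa [norm_delta_slicePt hnorm hK]
  have k1 := key J hJ
  have k2 := key (-J) (neg_mem_imagUnits hJ)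
  have k3 := ((k1.add k2).prodMk ((mulL (-J)).hasSum (k1.sub k2))).const_smul (1 / 2 : ℝ)
  simp only [mulL_apply, neg_mul] at k3
  rw [← eq_of_cEval hJ] at k3
  exact k3.congr_fun fun n => eq_of_cEval hJ _

/-- The spherical order is twice the order of the pole of the stem function at `z₀`. -/
theorem exists_hasSphericalExpansion_iff (h₀ : 0 < z₀.im) (hJ : J ∈ imagUnits A)
    (hF : HolNear z₀ F) (hind : InducedNear Ω f z₀ F) (m : ℕ) :
    (∃ c : ℤ → A, HasSphericalExpansion Ω f (slicePt J z₀) c ∧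
      ∀ n : ℤ, n < -((2 * m : ℕ) : ℤ) → c n = 0) ↔
    mulPow z₀ F m =O[𝓝[≠] z₀] (fun _ => (1 : ℝ)) := by
  constructor
  · rintro ⟨c, hc, hc0⟩
    obtain ⟨r, hr, hs⟩ := hc.exists_hasSum hnorm h₀.ne' hJ hind
    exact isBigO_one_of_hasSum_sphericalStem h₀.ne' hJ hc0 hr hs
  · intro h
    obtain ⟨c, hc0, r, hr, hs⟩ := exists_hasSum_sphericalStem h₀ hJ hF h
    exact ⟨c, HasSphericalExpansion.of_hasSum hnorm h₀ hJ hind hr hs, hc0⟩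

end Orders

/-! ### Infima of sets of natural numbers in `ℕ∞` -/

section ExtendedNat

variable {P Q : ℕ → Prop}

theorem sInf_natCast_eq_find [DecidablePred P] (h : ∃ m, P m) :
    sInf {N : ℕ∞ | ∃ m : ℕ, N = m ∧ P m} = (Nat.find h : ℕ) := by
  apply le_antisymm
  · exact sInf_le ⟨_, rfl, Nat.find_spec h⟩
  · refine le_sInf ?_
    rintro _ ⟨m, rfl, hm⟩
    exact_mod_cast Nat.find_min' h hm

theorem two_mul_sInf_lt_iff (hQ : ∀ m, Q m → Q (m + 1)) :
    2 * sInf {N : ℕ∞ | ∃ m : ℕ, N = m ∧ P m} < sInf {N : ℕ∞ | ∃ m : ℕ, N = (2 * m : ℕ) ∧ Q m} ↔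
      ∃ m, P m ∧ ¬ Q m := by
  classical
  constructor
  · intro h
    have hP : ∃ m, P m := by
      by_contra! hP
      have : {N : ℕ∞ | ∃ m : ℕ, N = m ∧ P m} = ∅ := by
        ext N; simp [hP]
      rw [this, sInf_empty] at h
      simp at h
    refine ⟨Nat.find hP, Nat.find_spec hP, fun hq => ?_⟩
    rw [sInf_natCast_eq_find hP] at h
    refine absurd h (not_lt.2 (sInf_le ⟨_, ?_, hq⟩))
    push_cast
    rfl
  · rintro ⟨m, hp, hq⟩
    have hmono : ∀ a b, a ≤ b → Q a → Q b := fun a b hab ha => Nat.le_induction ha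
      (fun n _ hn => hQ n hn) b hab
    have h1 : sInf {N : ℕ∞ | ∃ m : ℕ, N = m ∧ P m} ≤ m := sInf_le ⟨m, rfl, hp⟩
    have h2 : ((2 * m + 1 : ℕ) : ℕ∞) ≤ sInf {N : ℕ∞ | ∃ m : ℕ, N = (2 * m : ℕ) ∧ Q m} := by
      refine le_sInf ?_
      rintro _ ⟨k, rfl, hk⟩
      have : m < k := by
        by_contra hkm
        exact hq (hmono k m (not_lt.1 hkm) hk)
      exact_mod_cast (by omega : 2 * m + 1 ≤ 2 * k)
    refine lt_of_le_of_lt ?_ (lt_of_lt_of_le ?_ h2) (b := ((2 * m : ℕ) : ℕ∞))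
    · push_cast
      gcongr
    · exact_mod_cast Nat.lt_succ_self _

theorem two_mul_sInf_eq (hPQ : ∀ m, P m ↔ Q m) :
    2 * sInf {N : ℕ∞ | ∃ m : ℕ, N = m ∧ P m} =
      sInf {N : ℕ∞ | ∃ m : ℕ, N = (2 * m : ℕ) ∧ Q m} := by
  classical
  apply le_antisymm
  · refine le_sInf ?_
    rintro _ ⟨k, rfl, hk⟩
    have h1 : sInf {N : ℕ∞ | ∃ m : ℕ, N = m ∧ P m} ≤ k := sInf_le ⟨k, rfl, (hPQ k).2 hk⟩
    push_cast
    gcongr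
  · by_cases hP : ∃ m, P m
    · rw [sInf_natCast_eq_find hP]
      refine sInf_le ⟨Nat.find hP, by push_cast; rfl, (hPQ _).1 (Nat.find_spec hP)⟩
    · have : {N : ℕ∞ | ∃ m : ℕ, N = m ∧ P m} = ∅ := by
        push Not at hP
        ext N; simp [hP]
      rw [this, sInf_empty]
      simp

end ExtendedNat

/-! ### Comparison of the order and the spherical order -/

section Comparison

variable {A : Type*} [NormedNonAssocRing A] [NormedSpace ℝ A] [FiniteDimensional ℝ A]
  [StarRing A] [StarModule ℝ A] [IsScalarTower ℝ A A] [SMulCommClass ℝ A A] [Nontrivial A]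
  [IsAlternativeRing A] {z₀ : ℂ} {F : ℂ → A × A} {I J : A} {Ω : Set A} {f : A → A}

/-- The elements `J` of `A` for which there is an `N` such that `(z - z₀)^N F` is unbounded near `z₀`
and, whenever `m ≥ N` and `(z - z₀)^m F` is unbounded, its evaluation at `J` is bounded. For an
imaginary unit `J` this means that the pole of `ev_J ∘ F` has lower order than that of `F`, and
`m = N` suffices (`mem_lowPoles_iff`). For other `J`, boundedness at `N` need not pass to larger `m`;
the condition on all `m ≥ N` makes the set closed under affine combinations. -/
def lowPoles (z₀ : ℂ) (F : ℂ → A × A) : Set A :=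
  {J | ∃ N : ℕ, ¬ mulPow z₀ F N =O[𝓝[≠] z₀] (fun _ => (1 : ℝ)) ∧
    ∀ m, N ≤ m → ¬ mulPow z₀ F m =O[𝓝[≠] z₀] (fun _ => (1 : ℝ)) →
      (fun z => cEval J (mulPow z₀ F m z)) =O[𝓝[≠] z₀] (fun _ => (1 : ℝ))}

theorem mem_lowPoles_iff (hJ : J ∈ imagUnits A) :
    J ∈ lowPoles z₀ F ↔ ∃ m, (fun z => cEval J (mulPow z₀ F m z)) =O[𝓝[≠] z₀] (fun _ => (1 : ℝ)) ∧
      ¬ mulPow z₀ F m =O[𝓝[≠] z₀] (fun _ => (1 : ℝ)) := by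
  constructor
  · rintro ⟨N, hN, h⟩
    exact ⟨N, h N le_rfl hN, hN⟩
  · rintro ⟨N, h, hN⟩
    exact ⟨N, hN, fun m hm _ => Nat.le_induction h (fun n _ hn => isBigO_one_cEval_succ hJ hn) m hm⟩

/-- Two elements of `lowPoles` are handled by a common power of `z - z₀`. -/
theorem exists_of_mem_lowPoles (hI : I ∈ lowPoles z₀ F) (hJ : J ∈ lowPoles z₀ F) :
    ∃ N : ℕ, ¬ mulPow z₀ F N =O[𝓝[≠] z₀] (fun _ => (1 : ℝ)) ∧
      ∀ m, N ≤ m → ¬ mulPow z₀ F m =O[𝓝[≠] z₀] (fun _ => (1 : ℝ)) →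
        (fun z => cEval I (mulPow z₀ F m z)) =O[𝓝[≠] z₀] (fun _ => (1 : ℝ)) ∧
        (fun z => cEval J (mulPow z₀ F m z)) =O[𝓝[≠] z₀] (fun _ => (1 : ℝ)) := by
  obtain ⟨N, hN, h⟩ := hI
  obtain ⟨N', hN', h'⟩ := hJ
  refine ⟨max N N', ?_, fun m hm hq => ⟨h m (le_trans (le_max_left _ _) hm) hq,
    h' m (le_trans (le_max_right _ _) hm) hq⟩⟩
  rcases max_choice N N' with h | h <;> rwa [h]

theorem lineMap_mem_lowPoles (hI : I ∈ lowPoles z₀ F) (hJ : J ∈ lowPoles z₀ F) (t : ℝ) :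
    AffineMap.lineMap I J t ∈ lowPoles z₀ F := by
  obtain ⟨N, hN, h⟩ := exists_of_mem_lowPoles hI hJ
  refine ⟨N, hN, fun m hm hq => ?_⟩
  obtain ⟨h1, h2⟩ := h m hm hq
  refine ((h1.const_smul_left (1 - t)).add (h2.const_smul_left t)).congr_left fun z => ?_
  simp only [AffineMap.lineMap_apply_module, cEval, add_mul, smul_mul_assoc, Pi.smul_apply]
  module

theorem neg_notMem_lowPoles (hJ : J ∈ imagUnits A) (h : J ∈ lowPoles z₀ F) :
    -J ∉ lowPoles z₀ F := fun h' => by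
  obtain ⟨N, hN, hb⟩ := exists_of_mem_lowPoles h h'
  obtain ⟨h1, h2⟩ := hb N le_rfl hN
  exact hN (isBigO_one_of_isBigO_one_cEval hJ h1 h2)

/-- If `I - J` were not a left zero divisor, the boundedness of the evaluations of `(z - z₀)^m F` at
`I` and `J` would give that of its second component, hence of `(z - z₀)^m F` itself. -/
theorem exists_mul_eq_zero_of_mem_lowPoles (hI : I ∈ lowPoles z₀ F) (hJ : J ∈ lowPoles z₀ F) :
    ∃ b : A, (I - J) * b = 0 ∧ b ≠ 0 := by
  by_contra! hinj
  obtain ⟨N, hN, hb⟩ := exists_of_mem_lowPoles hI hJ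
  obtain ⟨h1, h2⟩ := hb N le_rfl hN
  refine hN ?_
  have hker : ((mulL (I - J) : A →L[ℝ] A) : A →ₗ[ℝ] A).ker = ⊥ :=
    LinearMap.ker_eq_bot'.2 fun b hb => hinj b hb
  obtain ⟨g, hg⟩ := LinearMap.exists_leftInverse_of_injective _ hker
  have hg' : ∀ b, g ((I - J) * b) = b := fun b => LinearMap.congr_fun hg b
  have h3 : (fun z => (mulPow z₀ F N z).2) =O[𝓝[≠] z₀] (fun _ => (1 : ℝ)) := by
    refine (((LinearMap.toContinuousLinearMap g).isBigO_comp _ _).trans (h1.sub h2)).congr_left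
      fun z => ?_
    simp only [cEval, add_sub_add_left_eq_sub, ← sub_mul]
    exact hg' _
  have h4 : (fun z => (mulPow z₀ F N z).1) =O[𝓝[≠] z₀] (fun _ => (1 : ℝ)) := by
    refine (h1.sub (((mulL I).isBigO_comp _ _).trans h3)).congr_left fun z => ?_
    simp [cEval]
  exact h4.prod_left h3

variable (hnorm : ∀ x ∈ quadraticCone A, (‖x‖ ^ 2 : ℝ) • (1 : A) = normSq x)
include hnorm

theorem order_slicePt (h₀ : 0 < z₀.im) (hJ : J ∈ imagUnits A) (hF : HolNear z₀ F)
    (hind : InducedNear Ω f z₀ F) :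
    order Ω f (slicePt J z₀) = sInf {N : ℕ∞ | ∃ m : ℕ, N = m ∧
      (fun z => cEval J (mulPow z₀ F m z)) =O[𝓝[≠] z₀] (fun _ => (1 : ℝ))} := by
  simp only [order, exists_hasLaurentExpansion_iff hnorm h₀.ne' hJ hF hind]

theorem sphericalOrder_slicePt (h₀ : 0 < z₀.im) (hJ : J ∈ imagUnits A) (hF : HolNear z₀ F)
    (hind : InducedNear Ω f z₀ F) :
    sphericalOrder Ω f (slicePt J z₀) = sInf {N : ℕ∞ | ∃ m : ℕ, N = (2 * m : ℕ) ∧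
      mulPow z₀ F m =O[𝓝[≠] z₀] (fun _ => (1 : ℝ))} := by
  rw [sphericalOrder]
  congr 1
  ext N
  simp only [Set.mem_ofPred_eq, ← exists_hasSphericalExpansion_iff hnorm h₀ hJ hF hind]
  constructor
  · rintro ⟨n₀, hn, rfl, h⟩
    obtain ⟨m, rfl⟩ := hn.two_dvd
    exact ⟨m, rfl, h⟩
  · rintro ⟨m, rfl, h⟩
    exact ⟨2 * m, even_two_mul m, rfl, h⟩

theorem two_mul_order_lt_iff (h₀ : 0 < z₀.im) (hJ : J ∈ imagUnits A) (hI : I ∈ imagUnits A)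
    (hF : HolNear z₀ F) (hind : InducedNear Ω f z₀ F) :
    2 * order Ω f (slicePt I z₀) < sphericalOrder Ω f (slicePt J z₀) ↔ I ∈ lowPoles z₀ F := by
  rw [order_slicePt hnorm h₀ hI hF hind, sphericalOrder_slicePt hnorm h₀ hJ hF hind,
    two_mul_sInf_lt_iff (Q := fun m => mulPow z₀ F m =O[𝓝[≠] z₀] (fun _ => (1 : ℝ)))
      fun m => isBigO_one_mulPow_succ, mem_lowPoles_iff hI]

theorem two_mul_order_eq (h₀ : 0 < z₀.im) (hJ : J ∈ imagUnits A) (hI : I ∈ imagUnits A)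
    (hF : HolNear z₀ F) (hind : InducedNear Ω f z₀ F) (h : I ∉ lowPoles z₀ F) :
    2 * order Ω f (slicePt I z₀) = sphericalOrder Ω f (slicePt J z₀) := by
  rw [order_slicePt hnorm h₀ hI hF hind, sphericalOrder_slicePt hnorm h₀ hJ hF hind]
  rw [mem_lowPoles_iff hI] at h
  push Not at h
  exact two_mul_sInf_eq fun m => ⟨h m, isBigO_one_cEval_of_isBigO_one I⟩

end Comparison

end SliceAnalysis

/-! ### Real algebraic sets -/

namespace RealAlgebraic

variable {E : Type*} [AddCommGroup E] [Module ℝ E]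

theorem isClosed_zariski_iff {V : Set E} : IsClosed[zariskiTopology E] V ↔ IsAlgebraicSet V := by
  rw [← @isOpen_compl_iff E V (zariskiTopology E)]
  change IsAlgebraicSet (Vᶜᶜ) ↔ _
  rw [compl_compl]

theorem dual_mem_polyFun (l : Module.Dual ℝ E) : (l : E → ℝ) ∈ polyFun E :=
  Algebra.subset_adjoin ⟨l, rfl⟩

theorem const_mem_polyFun (r : ℝ) : (fun _ => r : E → ℝ) ∈ polyFun E :=
  (polyFun E).algebraMap_mem r

/-- An affine subspace is cut out by the linear forms that are constant on it. -/
theorem isAlgebraicSet_affineSubspace (H : AffineSubspace ℝ E) : IsAlgebraicSet (H : Set E) := by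
  rcases H.eq_bot_or_nonempty with rfl | ⟨p, hp⟩
  · exact ⟨{1}, by rintro _ rfl; exact (polyFun E).one_mem, by ext x; simp⟩
  · refine ⟨{g | ∃ l : Module.Dual ℝ E, H.direction ≤ l.ker ∧ g = fun x => l x - l p}, ?_, ?_⟩
    · rintro _ ⟨l, -, rfl⟩
      exact (polyFun E).sub_mem (dual_mem_polyFun l) (const_mem_polyFun (l p))
    · ext x
      constructor
      · rintro hx _ ⟨l, hl, rfl⟩
        have := hl (AffineSubspace.vsub_mem_direction hx hp)
        simpa using this
      · intro h
        have hx : x - p ∈ H.direction := by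
          by_contra hx
          obtain ⟨l, hl, hker⟩ := Submodule.exists_le_ker_of_notMem hx
          exact hl (by simpa using h _ ⟨l, hker, rfl⟩)
        have := AffineSubspace.vadd_mem_of_mem_direction hx hp
        simpa using this

theorem isPreirreducible_zariski_iff {Y : Set E} : @IsPreirreducible E (zariskiTopology E) Y ↔
    ∀ V W : Set E, IsAlgebraicSet V → IsAlgebraicSet W → Y ⊆ V ∪ W → Y ⊆ V ∨ Y ⊆ W := by
  let _ := zariskiTopology E
  rw [isPreirreducible_iff_isClosed_union_isClosed]
  simp only [isClosed_zariski_iff]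

/-- Irreducible components of algebraic sets are algebraic. -/
theorem IsIrreducibleComponent.isAlgebraicSet {V Y : Set E} (hV : IsAlgebraicSet V)
    (h : IsIrreducibleComponent V Y) : IsAlgebraicSet Y := by
  let _ := zariskiTopology E
  have hc : IsClosed Y := by
    have h1 : closure Y ⊆ V := closure_minimal h.prop.1 (isClosed_zariski_iff.2 hV)
    have h2 := h.le_of_ge (y := closure Y) ⟨h1, h.prop.2.closure⟩ subset_closure
    exact isClosed_of_closure_subset h2
  exact isClosed_zariski_iff.1 hc

theorem IsAlgebraicSet.inter {V W : Set E} (hV : IsAlgebraicSet V) (hW : IsAlgebraicSet W) :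
    IsAlgebraicSet (V ∩ W) := by
  let _ := zariskiTopology E
  exact isClosed_zariski_iff.1
    ((isClosed_zariski_iff.2 hV).inter (isClosed_zariski_iff.2 hW))

theorem IsAlgebraicSet.union {V W : Set E} (hV : IsAlgebraicSet V) (hW : IsAlgebraicSet W) :
    IsAlgebraicSet (V ∪ W) := by
  let _ := zariskiTopology E
  exact isClosed_zariski_iff.1
    ((isClosed_zariski_iff.2 hV).union (isClosed_zariski_iff.2 hW))

theorem mem_polyFunOn {V : Set E} {g : V → ℝ} :
    g ∈ polyFunOn V ↔ ∃ p ∈ polyFun E, g = fun x => p x.1 := by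
  rw [polyFunOn, Subalgebra.mem_map]
  constructor
  · rintro ⟨p, hp, rfl⟩
    exact ⟨p, hp, rfl⟩
  · rintro ⟨p, hp, rfl⟩
    exact ⟨p, hp, rfl⟩

/-- The ring of polynomial functions is a quotient of a polynomial ring in finitely many
variables. -/
theorem exists_surjective_mvPolynomial [FiniteDimensional ℝ E] (V : Set E) :
    ∃ φ : MvPolynomial (Fin (Module.finrank ℝ E)) ℝ →ₐ[ℝ] polyFunOn V, Function.Surjective φ := by
  set b := Module.finBasis ℝ E with hb
  set ψ : MvPolynomial (Fin (Module.finrank ℝ E)) ℝ →ₐ[ℝ] (E → ℝ) :=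
    MvPolynomial.aeval fun i => (b.coord i : E → ℝ) with hψ
  have hrange : polyFun E = ψ.range := by
    apply le_antisymm
    · refine Algebra.adjoin_le ?_
      rintro _ ⟨l, rfl⟩
      refine ⟨∑ i, MvPolynomial.C (l (b i)) * MvPolynomial.X i, ?_⟩
      ext x
      have hx : l x = ∑ i, l (b i) * b.repr x i := by
        conv_lhs => rw [← b.sum_repr x, map_sum]
        exact Finset.sum_congr rfl fun i _ => by rw [map_smul, smul_eq_mul, mul_comm]
      simp [hψ, hx, Finset.sum_apply]
    · rw [hψ, ← Algebra.adjoin_range_eq_range_aeval]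
      refine Algebra.adjoin_le ?_
      rintro _ ⟨i, rfl⟩
      exact dual_mem_polyFun _
  have h2 : polyFunOn V =
      ((AlgHom.pi fun x : V => Pi.evalAlgHom ℝ (fun _ : E => ℝ) x.1).comp ψ).range := by
    rw [polyFunOn, hrange, AlgHom.range_comp]
  rw [h2]
  exact ⟨_, AlgHom.rangeRestrict_surjective _⟩

/-- A proper algebraic subset of an irreducible algebraic set has smaller dimension. -/
theorem dim_lt_dim [FiniteDimensional ℝ E] {Y Y' : Set E}
    (hY : @IsIrreducible E (zariskiTopology E) Y) (hY' : IsAlgebraicSet Y') (hsub : Y' ⊆ Y)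
    (hne : Y' ≠ Y) : dim Y' < dim Y := by
  obtain ⟨x₀, hx₀⟩ := hY.1
  have hirr := isPreirreducible_zariski_iff.1 hY.2
  have hnt : Nontrivial (polyFunOn Y) := by
    refine ⟨0, 1, fun h => ?_⟩
    have := congrArg (fun g : polyFunOn Y => (g : Y → ℝ) ⟨x₀, hx₀⟩) h
    simp at this
  have hzero : ∀ p ∈ polyFun E, IsAlgebraicSet {x | p x = 0} := fun p hp =>
    ⟨{p}, by rintro _ rfl; exact hp, by ext x; simp⟩
  have hdom : NoZeroDivisors (polyFunOn Y) := by
    refine ⟨?_⟩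
    rintro ⟨g, hg⟩ ⟨g', hg'⟩ hgg
    obtain ⟨p, hp, rfl⟩ := mem_polyFunOn.1 hg
    obtain ⟨p', hp', rfl⟩ := mem_polyFunOn.1 hg'
    have hmul : ∀ x ∈ Y, p x * p' x = 0 := fun x hx =>
      congrFun (congrArg Subtype.val hgg) ⟨x, hx⟩
    rcases hirr _ _ (hzero p hp) (hzero p' hp') fun x hx => mul_eq_zero.1 (hmul x hx) with h | h
    · exact Or.inl (Subtype.ext (funext fun x => h x.2))
    · exact Or.inr (Subtype.ext (funext fun x => h x.2))
  -- a polynomial function that vanishes on `Y'` but not on `Y`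
  obtain ⟨p, hp, hp', x, hx, hpx⟩ : ∃ p ∈ polyFun E, (∀ x ∈ Y', p x = 0) ∧ ∃ x ∈ Y, p x ≠ 0 := by
    obtain ⟨S, hS, rfl⟩ := hY'
    by_contra! hc
    refine hne (hsub.antisymm fun x hx p hp => hc p (hS hp) (fun z hz => hz p hp) x hx)
  set r : polyFunOn Y := ⟨fun x => p x, mem_polyFunOn.2 ⟨p, hp, rfl⟩⟩ with hr
  have hr0 : r ≠ 0 := fun h => hpx (congrFun (congrArg Subtype.val h) ⟨x, hx⟩)
  have hstep := ringKrullDim_quotient_succ_le_of_nonZeroDivisor (mem_nonZeroDivisors_of_ne_zero hr0)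
  -- restriction to `Y'` factors through the quotient by `r`
  let res : polyFunOn Y →+* polyFunOn Y' :=
    { toFun := fun g => ⟨fun x => (g : Y → ℝ) ⟨x, hsub x.2⟩, by
        obtain ⟨q, hq, hgq⟩ := mem_polyFunOn.1 g.2
        exact mem_polyFunOn.2 ⟨q, hq, by rw [hgq]⟩⟩
      map_one' := rfl
      map_mul' := fun _ _ => rfl
      map_zero' := rfl
      map_add' := fun _ _ => rfl }
  have hres : Function.Surjective res := by
    rintro ⟨g, hg⟩
    obtain ⟨q, hq, rfl⟩ := mem_polyFunOn.1 hg
    exact ⟨⟨fun x => q x, mem_polyFunOn.2 ⟨q, hq, rfl⟩⟩, rfl⟩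
  have hker : ∀ a ∈ Ideal.span {r}, res a = 0 := fun a ha => by
    obtain ⟨c, rfl⟩ := Ideal.mem_span_singleton'.1 ha
    rw [map_mul]
    have : res r = 0 := Subtype.ext (funext fun x => hp' x x.2)
    rw [this, mul_zero]
  have hle : dim Y' ≤ ringKrullDim (polyFunOn Y ⧸ Ideal.span {r}) :=
    ringKrullDim_le_of_surjective (Ideal.Quotient.lift _ res hker)
      (Ideal.Quotient.lift_surjective_of_surjective _ _ hres)
  -- finiteness makes the inequality `dim Y' + 1 ≤ dim Y` strict without the `1`
  have hfin : dim Y ≤ (Module.finrank ℝ E : WithBot ℕ∞) := by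
    obtain ⟨φ, hφ⟩ := exists_surjective_mvPolynomial Y
    have h1 := ringKrullDim_le_of_surjective φ.toRingHom hφ
    rw [MvPolynomial.ringKrullDim_of_isNoetherianRing, ringKrullDim_eq_zero_of_field] at h1
    rw [dim]
    simpa using h1
  have h0 : (0 : WithBot ℕ∞) ≤ dim Y := ringKrullDim_nonneg_of_nontrivial
  have hlt : dim Y' + 1 ≤ dim Y := (add_le_add_left hle 1).trans hstep
  generalize dim Y' = a at hlt
  generalize dim Y = c at hlt h0 hfin
  induction a with
  | bot => exact lt_of_lt_of_le (WithBot.bot_lt_coe 0) h0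
  | coe a =>
    induction a with
    | top =>
      have := hlt.trans hfin
      exact absurd this (by
        rw [not_le]
        exact WithBot.coe_lt_coe.2 (by simp))
    | coe a =>
      refine lt_of_lt_of_le ?_ hlt
      exact_mod_cast Nat.lt_succ_self a

end RealAlgebraic

namespace SliceAnalysis

open RealAlgebraic

/-! ### The sphere as a real algebraic set -/

section Sphere

variable {A : Type*} [NormedNonAssocRing A] [NormedSpace ℝ A] [FiniteDimensional ℝ A]
  [StarRing A] [StarModule ℝ A] [IsScalarTower ℝ A A] [SMulCommClass ℝ A A] [Nontrivial A]
  {z₀ : ℂ} {J : A}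

/-- The sphere through a nonreal point is a level set of the trace and of the squared norm. -/
theorem mem_sphere_iff_trace_normSq (h₀ : z₀.im ≠ 0) (hJ : J ∈ imagUnits A) {x : A} :
    (∃ I ∈ imagUnits A, x = slicePt I z₀) ↔
      trace x = (2 * z₀.re) • (1 : A) ∧ normSq x = Complex.normSq z₀ • (1 : A) := by
  constructor
  · rintro ⟨I, hI, rfl⟩
    exact ⟨trace_slicePt hI z₀, normSq_slicePt hI z₀⟩
  · rintro ⟨ht, hn⟩
    have hx : x ∈ quadraticCone A := by
      right
      refine ⟨⟨_, ht.symm⟩, ⟨_, hn.symm⟩, ?_⟩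
      rw [ht, hn, toReal_smul_one, toReal_smul_one, Complex.normSq_apply]
      have := mul_self_pos.2 h₀
      nlinarith
    obtain ⟨I, hI, z, rfl⟩ := exists_slicePt_of_mem_quadraticCone hJ hx
    rw [trace_slicePt hI, smul_one_inj] at ht
    rw [normSq_slicePt hI, smul_one_inj, Complex.normSq_apply, Complex.normSq_apply] at hn
    have hre : z.re = z₀.re := by linarith
    have him : z.im = z₀.im ∨ z.im = -z₀.im := by
      rw [hre] at hn
      exact mul_self_eq_mul_self_iff.1 (by linarith)
    rcases him with h | h
    · exact ⟨I, hI, by rw [Complex.ext hre h]⟩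
    · refine ⟨-I, neg_mem_imagUnits hI, ?_⟩
      rw [slicePt_neg]
      congr 1
      exact Complex.ext (by simpa using hre) (by simpa using h)

theorem isAlgebraicSet_sphere (h₀ : z₀.im ≠ 0) (hJ : J ∈ imagUnits A) :
    IsAlgebraicSet {x : A | ∃ I ∈ imagUnits A, x = slicePt I z₀} := by
  refine ⟨{g | ∃ l : Module.Dual ℝ A, g = (fun x => l (trace x) - l ((2 * z₀.re) • (1 : A))) ∨
    g = (fun x => l (normSq x) - l (Complex.normSq z₀ • (1 : A)))}, ?_, ?_⟩
  · rintro _ ⟨l, rfl | rfl⟩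
    · exact (polyFun A).sub_mem (dual_mem_polyFun (l ∘ₗ (LinearMap.id + starLin A))) (const_mem_polyFun _)
    · refine (polyFun A).sub_mem ?_ (const_mem_polyFun _)
      -- `n(x)` is bilinear in `x` and `star x`
      set b := Module.finBasis ℝ A with hb
      have h : (fun x => l (normSq x)) = ∑ i, (b.coord i : A → ℝ) *
          ((l ∘ₗ LinearMap.mulLeft ℝ (b i) ∘ₗ starLin A : Module.Dual ℝ A) : A → ℝ) := by
        ext x
        have hx : normSq x = ∑ i, b.repr x i • (b i * star x) := by
          simp only [← smul_mul_assoc, ← Finset.sum_mul, b.sum_repr]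
          rfl
        rw [hx, map_sum, Finset.sum_apply]
        refine Finset.sum_congr rfl fun i _ => ?_
        simp
      rw [h]
      exact (polyFun A).sum_mem fun i _ =>
        (polyFun A).mul_mem (dual_mem_polyFun _) (dual_mem_polyFun _)
  · ext x
    rw [Set.mem_ofPred_eq, mem_sphere_iff_trace_normSq h₀ hJ]
    constructor
    · rintro ⟨ht, hn⟩ _ ⟨l, rfl | rfl⟩
      · simp only [ht, sub_self]
      · simp only [hn, sub_self]
    · intro h
      constructor
      · rw [← sub_eq_zero, ← Module.forall_dual_apply_eq_zero_iff ℝ]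
        intro l
        rw [map_sub]
        exact h _ ⟨l, Or.inl rfl⟩
      · rw [← sub_eq_zero, ← Module.forall_dual_apply_eq_zero_iff ℝ]
        intro l
        rw [map_sub]
        exact h _ ⟨l, Or.inr rfl⟩

variable (hnorm : ∀ x ∈ quadraticCone A, (‖x‖ ^ 2 : ℝ) • (1 : A) = normSq x)
include hnorm

theorem sphere_slicePt (hJ : J ∈ imagUnits A) :
    sphere (slicePt J z₀) = {x : A | ∃ I ∈ imagUnits A, x = slicePt I z₀} := by
  ext x
  constructor
  · rintro ⟨z, K, hK, I, hI, hz, rfl⟩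
    rcases (slicePt_eq_slicePt hnorm hK hJ hz).1 with rfl | rfl
    · exact ⟨I, hI, rfl⟩
    · exact ⟨-I, neg_mem_imagUnits hI, by rw [slicePt_conj_neg]⟩
  · rintro ⟨I, hI, rfl⟩
    exact ⟨z₀, J, hJ, I, hI, rfl, rfl⟩

end Sphere

/-! ### The exceptional subspace -/

section Exceptional

variable {A : Type*} [NormedNonAssocRing A] [NormedSpace ℝ A] [FiniteDimensional ℝ A]
  [StarRing A] [StarModule ℝ A] [IsScalarTower ℝ A A] [SMulCommClass ℝ A A] [Nontrivial A]
  [IsAlternativeRing A] {z₀ : ℂ} {F : ℂ → A × A} {I J : A}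

variable (z₀ F) in
/-- The affine subspace `α + β K`, where `z₀ = α + β i` and `K = lowPoles z₀ F`. -/
def exceptionalSubspace : AffineSubspace ℝ A where
  carrier := {x | z₀.im⁻¹ • (x - z₀.re • (1 : A)) ∈ lowPoles z₀ F}
  smul_vsub_vadd_mem' := by
    intro c p₁ p₂ p₃ h₁ h₂ h₃
    rw [Set.mem_ofPred_eq] at h₁ h₂ h₃ ⊢
    -- the point is reached from `p₁`, `p₂`, `p₃` by three affine combinations of two points
    have h₄ := lineMap_mem_lowPoles h₂ (lineMap_mem_lowPoles
      (lineMap_mem_lowPoles h₂ h₁ c) h₃ (1 / 2)) 2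
    refine (congrArg (· ∈ lowPoles z₀ F) ?_).mp h₄
    simp only [AffineMap.lineMap_apply_module, vsub_eq_sub, vadd_eq_add]
    module

theorem mem_exceptionalSubspace {x : A} : x ∈ exceptionalSubspace z₀ F ↔
    z₀.im⁻¹ • (x - z₀.re • (1 : A)) ∈ lowPoles z₀ F := Iff.rfl

theorem slicePt_mem_exceptionalSubspace (h₀ : z₀.im ≠ 0) :
    slicePt J z₀ ∈ exceptionalSubspace z₀ F ↔ J ∈ lowPoles z₀ F := by
  rw [mem_exceptionalSubspace, slicePt, add_sub_cancel_left, inv_smul_smul₀ h₀]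

end Exceptional

/-- A connected set that meets one of two closed sets, disjoint on it, lies in the first one or is
not covered by them. -/
theorem subset_or_nonempty_of_isConnected {X : Type*} [TopologicalSpace X] {W H H' : Set X}
    (hW : IsConnected W) (hH : IsClosed H) (hH' : IsClosed H') {y : X} (hyW : y ∈ W) (hyH : y ∈ H)
    (hdisj : ∀ x ∈ W, x ∈ H → x ∉ H') : W ⊆ H ∨ (W ∩ (H ∪ H')ᶜ).Nonempty := by
  by_contra! hc
  obtain ⟨hWH, hc⟩ := hc
  have hcov : W ⊆ H ∪ H' := fun x hx => by
    by_contra hx'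
    exact (hc ▸ (⟨hx, hx'⟩ : x ∈ W ∩ (H ∪ H')ᶜ) : x ∈ (∅ : Set X))
  obtain ⟨x, hx, hxH⟩ := Set.not_subset.1 hWH
  obtain ⟨z, hz, hzH, hzH'⟩ := isPreconnected_closed_iff.1 hW.2 H H' hH hH' hcov ⟨y, hyW, hyH⟩
    ⟨x, hx, (hcov hx).resolve_left hxH⟩
  exact hdisj z hz hzH hzH'

end SliceAnalysis

open SliceAnalysis RealAlgebraic

theorem mainTheorem3 {A : Type*} [NormedNonAssocRing A] [NormedSpace ℝ A] [StarRing A]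
    [StarModule ℝ A] [IsScalarTower ℝ A A] [SMulCommClass ℝ A A] [Nontrivial A]
    [FiniteDimensional ℝ A] [IsAlternativeRing A]
    (hnorm : ∀ x ∈ SliceAnalysis.quadraticCone A,
      (‖x‖ ^ 2 : ℝ) • (1 : A) = SliceAnalysis.normSq x)
    (Ω : Set A) (f : A → A) (hf : SliceAnalysis.IsSliceRegularOn Ω f)
    (y : A) (hyQ : y ∈ SliceAnalysis.quadraticCone A) (hyR : y ∉ SliceAnalysis.realLine A)
    (hy : SliceAnalysis.IsSingularity Ω y)
    (hlt : 2 * SliceAnalysis.order Ω f y < SliceAnalysis.sphericalOrder Ω f y) :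
    -- the exceptional set is cut out by a real affine subspace through `y`
    (∃ H : AffineSubspace ℝ A, y ∈ H ∧
      {x | x ∈ SliceAnalysis.sphere y ∧
        2 * SliceAnalysis.order Ω f x < SliceAnalysis.sphericalOrder Ω f y} =
      SliceAnalysis.sphere y ∩ (H : Set A)) ∧
    -- connected subsets, for the Euclidean and for the Zariski topology
    (∀ τ : TopologicalSpace A,
      (τ = SliceAnalysis.euclideanTopology A ∨
        τ = RealAlgebraic.zariskiTopology A) →
      ∀ W : Set A, W ⊆ SliceAnalysis.sphere y → y ∈ W → @IsConnected A τ W →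
        ((∀ x ∈ W, 2 * SliceAnalysis.order Ω f x < SliceAnalysis.sphericalOrder Ω f y ∧
            SliceAnalysis.sphericalOrder Ω f y = 2 * SliceAnalysis.order Ω f (star x)) ∨
          (∃ W' : Set A, W'.Nonempty ∧ (∃ O : Set A, @IsOpen A τ O ∧ W' = W ∩ O) ∧
            ∀ x ∈ W', 2 * SliceAnalysis.order Ω f x = SliceAnalysis.sphericalOrder Ω f y ∧
              SliceAnalysis.sphericalOrder Ω f y = 2 * SliceAnalysis.order Ω f (star x))) ∧
        ((star '' W = W ∨
          (W ∩ star '' W).Nonempty ∨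
          (∃ y' ∈ W, ∃ y'' ∈ W, y' ≠ y'' ∧ ∀ b : A, (y' - y'') * b = 0 → b = 0) ∨
          (∃ y' ∈ W, 2 * SliceAnalysis.order Ω f y' = SliceAnalysis.sphericalOrder Ω f y)) →
          ¬ ∀ x ∈ W, 2 * SliceAnalysis.order Ω f x < SliceAnalysis.sphericalOrder Ω f y ∧
            SliceAnalysis.sphericalOrder Ω f y = 2 * SliceAnalysis.order Ω f (star x))) ∧
    -- irreducible components
    (∀ Y : Set A, RealAlgebraic.IsIrreducibleComponent (SliceAnalysis.sphere y) Y → y ∈ Y →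
      ((∀ x ∈ Y, 2 * SliceAnalysis.order Ω f x < SliceAnalysis.sphericalOrder Ω f y ∧
          SliceAnalysis.sphericalOrder Ω f y = 2 * SliceAnalysis.order Ω f (star x)) ∨
        (∃ Y' : Set A, Y' ⊆ Y ∧ RealAlgebraic.IsAlgebraicSet Y' ∧
          RealAlgebraic.dim Y' < RealAlgebraic.dim Y ∧
          ∀ x ∈ Y \ Y', 2 * SliceAnalysis.order Ω f x = SliceAnalysis.sphericalOrder Ω f y ∧
            2 * SliceAnalysis.order Ω f (star x) = SliceAnalysis.sphericalOrder Ω f y))) := by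
  -- a representation of `y` with positive imaginary part
  obtain ⟨J, hJ, z₀, h₀, rfl⟩ : ∃ J ∈ imagUnits A, ∃ z₀ : ℂ, 0 < z₀.im ∧ y = slicePt J z₀ := by
    obtain ⟨J, hJ, z, rfl⟩ := exists_slicePt_of_notMem_realLine hyQ hyR
    have hz : z.im ≠ 0 := fun h => hyR ⟨z.re, by simp [slicePt, h]⟩
    rcases lt_or_gt_of_ne hz with h | h
    · exact ⟨-J, neg_mem_imagUnits hJ, conj z, by simpa using h, (slicePt_conj_neg J z).symm⟩
    · exact ⟨J, hJ, z, h, rfl⟩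
  obtain ⟨F, hF, hind⟩ := exists_stem_near hnorm hf hJ hy
  rw [sphere_slicePt hnorm hJ]
  set s := sphericalOrder Ω f (slicePt J z₀) with hs
  set H := exceptionalSubspace z₀ F with hH
  set H' := H.comap (starLin A).toAffineMap with hH'
  -- the exceptional points of the sphere and their conjugates
  have hstar : ∀ {I : A}, I ∈ imagUnits A → star (slicePt I z₀) = slicePt (-I) z₀ := fun hI =>
    star_slicePt hI z₀
  have hmem : ∀ {x : A}, (∃ I ∈ imagUnits A, x = slicePt I z₀) →
      (2 * order Ω f x < s ↔ x ∈ H) := by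
    rintro _ ⟨I, hI, rfl⟩
    rw [two_mul_order_lt_iff hnorm h₀ hJ hI hF hind, slicePt_mem_exceptionalSubspace h₀.ne']
  have heq : ∀ {x : A}, (∃ I ∈ imagUnits A, x = slicePt I z₀) → x ∉ H →
      2 * order Ω f x = s := by
    rintro _ ⟨I, hI, rfl⟩ hx
    rw [slicePt_mem_exceptionalSubspace h₀.ne'] at hx
    exact two_mul_order_eq hnorm h₀ hJ hI hF hind hx
  have hsph : ∀ {x : A}, (∃ I ∈ imagUnits A, x = slicePt I z₀) →
      ∃ I ∈ imagUnits A, star x = slicePt I z₀ := by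
    rintro _ ⟨I, hI, rfl⟩
    exact ⟨-I, neg_mem_imagUnits hI, hstar hI⟩
  have hdisj : ∀ {x : A}, (∃ I ∈ imagUnits A, x = slicePt I z₀) → x ∈ H → star x ∉ H := by
    rintro _ ⟨I, hI, rfl⟩ hx
    rw [hstar hI, slicePt_mem_exceptionalSubspace h₀.ne']
    exact neg_notMem_lowPoles hI ((slicePt_mem_exceptionalSubspace h₀.ne').1 hx)
  have hyH : slicePt J z₀ ∈ H := (hmem ⟨J, hJ, rfl⟩).1 hlt
  have hH'mem : ∀ {x : A}, x ∈ H' ↔ star x ∈ H := Iff.rfl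
  have halg : IsAlgebraicSet ((H : Set A) ∪ H') :=
    (isAlgebraicSet_affineSubspace H).union (isAlgebraicSet_affineSubspace H')
  refine ⟨⟨H, hyH, ?_⟩, ?_, ?_⟩
  · ext x
    exact ⟨fun hx => ⟨hx.1, (hmem hx.1).1 hx.2⟩, fun hx => ⟨hx.1, (hmem hx.1).2 hx.2⟩⟩
  · intro τ hτ W hWS hyW hW
    have hclosed : IsClosed[τ] (H : Set A) ∧ IsClosed[τ] (H' : Set A) := by
      rcases hτ with rfl | rfl
      · exact ⟨H.closed_of_finiteDimensional, H'.closed_of_finiteDimensional⟩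
      · exact ⟨isClosed_zariski_iff.2 (isAlgebraicSet_affineSubspace H),
          isClosed_zariski_iff.2 (isAlgebraicSet_affineSubspace H')⟩
    refine ⟨?_, ?_⟩
    · rcases @subset_or_nonempty_of_isConnected A τ W H H' hW hclosed.1 hclosed.2 _ hyW hyH
        fun x hx hxH => hdisj (hWS hx) hxH with h | h
      · exact Or.inl fun x hx => ⟨(hmem (hWS hx)).2 (h hx),
          (heq (hsph (hWS hx)) (hdisj (hWS hx) (h hx))).symm⟩
      · refine Or.inr ⟨_, h, ⟨_, ?_, rfl⟩, fun x hx => ?_⟩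
        · exact (@isOpen_compl_iff A _ τ).2 (@IsClosed.union A _ _ τ hclosed.1 hclosed.2)
        · have hx1 : x ∉ H := fun h => hx.2 (Or.inl h)
          have hx2 : star x ∉ H := fun h => hx.2 (Or.inr h)
          exact ⟨heq (hWS hx.1) hx1, (heq (hsph (hWS hx.1)) hx2).symm⟩
    · intro hex hall
      have hWH : ∀ x ∈ W, x ∈ H := fun x hx => (hmem (hWS hx)).1 (hall x hx).1
      rcases hex with h | ⟨_, hx, x, hxW, rfl⟩ | ⟨y', hy', y'', hy'', -, hinj⟩ | ⟨y', hy', h⟩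
      · have : star (slicePt J z₀) ∈ W := h ▸ Set.mem_image_of_mem star hyW
        exact hdisj (hWS hyW) hyH (hWH _ this)
      · exact hdisj (hWS hxW) (hWH x hxW) (hWH _ hx)
      · obtain ⟨I', hI', rfl⟩ := hWS hy'
        obtain ⟨I'', hI'', rfl⟩ := hWS hy''
        have h1 := (slicePt_mem_exceptionalSubspace h₀.ne').1 (hWH _ hy')
        have h2 := (slicePt_mem_exceptionalSubspace h₀.ne').1 (hWH _ hy'')
        obtain ⟨b, hb, hb0⟩ := exists_mul_eq_zero_of_mem_lowPoles h1 h2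
        refine hb0 (hinj b ?_)
        have : slicePt I' z₀ - slicePt I'' z₀ = z₀.im • (I' - I'') := by
          simp only [slicePt, smul_sub]
          abel
        rw [this, smul_mul_assoc, hb, smul_zero]
      · exact absurd h (hall y' hy').1.ne
  · intro Y hY hyY
    have hYS := hY.prop.1
    by_cases hYH : Y ⊆ H
    · exact Or.inl fun x hx => ⟨(hmem (hYS hx)).2 (hYH hx),
        (heq (hsph (hYS hx)) (hdisj (hYS hx) (hYH hx))).symm⟩
    · have hYalg : IsAlgebraicSet Y :=
        hY.isAlgebraicSet (isAlgebraicSet_sphere h₀.ne' hJ)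
      refine Or.inr ⟨Y ∩ (H ∪ H'), Set.inter_subset_left, hYalg.inter halg,
        dim_lt_dim hY.prop.2 (hYalg.inter halg) Set.inter_subset_left fun h => ?_, fun x hx => ?_⟩
      · rcases isPreirreducible_zariski_iff.1 hY.prop.2.2 _ _ (isAlgebraicSet_affineSubspace H)
          (isAlgebraicSet_affineSubspace H') (Set.inter_eq_left.1 h) with h | h
        · exact hYH h
        · exact hdisj (hYS hyY) hyH (h hyY)
      · have hx1 : x ∉ H := fun h => hx.2 ⟨hx.1, Or.inl h⟩
        have hx2 : star x ∉ H := fun h => hx.2 ⟨hx.1, Or.inr h⟩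
        exact ⟨heq (hYS hx.1) hx1, heq (hsph (hYS hx.1)) hx2⟩
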